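/- Let $G$ be a local Lie group with finite-dimensional real Lie algebra $\mathfrak g$, referred to normal coordinates (a neighbourhood of $e$ is identified with a neighbourhood of $0$ in $\mathfrak g$ by $\exp$). Let $H$ be a closed local Lie subgroup with Lie algebra $\mathfrak h$ (so $H=\exp\mathfrak h$ near $e$), and let $Q\ni e$ be a smooth local section of the left cosets of $H$ with tangent space $V=T_eQ$, so $\mathfrak g=V\oplus\mathfrak h$. Let $\Pi:\mathfrak g\to V$ be the projection parallel to $\mathfrak h$. Write $Q=\{\exp(\xi+\varphi(\xi)):\xi\in V\text{ near }0\}$, where $\varphi:V\to\mathfrak h$ is smooth near $0$, $\varphi(0)=0$, $d\varphi(0)=0$; then $\varphi(\xi)=R(\xi,\xi)+o(|\xi|^2)$ with $R:V\times V\to\mathfrak h$ bilinear and symmetric. We use $\xi\in V$ as coordinate on $Q$, and write $u\in V$ also for the point $\exp(u+\varphi(u))$ of $Q$. Let $x\times y=\Pi_Q(xy)$ be the local loop on $Q$, where $\Pi_Q:G\to Q$ is the projection parallel to $H$, and let $\mu$ be its multiplication in the coordinate $V$. On a neighbourhood of $(e,e)$ in $Q\times Q$ consider the 3-web of this loop with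 its Chern connection. Put $P^i_\alpha=\partial\mu^i/\partial x^\alpha$, $Q^i_\beta=\partial\mu^i/\partial y^\beta$, with inverse matrices $\widetilde P,\widetilde Q$, and $$\omega_1=P\,dx,\quad \omega_2=Q\,dy,\quad \Gamma^k_{ij}=-\widetilde P^\alpha_i\widetilde Q^\beta_j\frac{\partial^2\mu^k}{\partial x^\alpha\partial y^\beta},\quad \omega^k_j=\Gamma^k_{ij}\omega_1^i+\Gamma^k_{jl}\omega_2^l .$$ The torsion tensor is $a^k_{ij}=\frac12(\Gamma^k_{ij}-\Gamma^k_{ji})$, the curvature tensor $b$ is defined by $d\omega^k_j=\omega^i_j\wedge\omega^k_i+b^k_{jlm}\,\omega_1^l\wedge\omega_2^m$, and $\overset1\nabla_l a,\overset2\nabla_l a$ by $$da^k_{ij}+a^l_{ij}\omega^k_l-a^k_{lj}\omega^l_i-a^k_{il}\omega^l_j=\overset1\nabla_l a^k_{ij}\,\omega_1^l+\overset2\nabla_l a^k_{ij}\,\omega_2^l .$$ Below, $\overset1\nabla_la^i_{jk},\overset2\nabla_la^i_{jk}$ and $b$ are taken at $(e,e)$, $b(\xi,\eta,\zeta)^i=b^i_{jlm}\xi^j\eta^l\zeta^m$,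 and the torsion tensor at the neutral element of an arbitrary local loop is the value of its tensor $a$ at $(e,e)$. For $g\in G$ near $e$ let $a''_g$ be the torsion tensor at $e$ of the local loop $(x,y)\mapsto\Pi''_g(xy)$ on $Q$, where $\Pi''_g:G\to Q$ is the projection parallel to $gHg^{-1}$. For $u\in Q$ near $e$ let $\Psi_u(x)=(u\times x)u^{-1}$, $Q'_u=Qu^{-1}=\Psi_u(Q)$, and let $\tilde a_u$ be the torsion tensor at $e$ of the local loop $(p,q)\mapsto\Pi'_u(pq)$ on $Q'_u$ ($\Pi'_u:G\to Q'_u$ the projection parallel to $uHu^{-1}$), transported to $Q$ by $\Psi_u$. Then for all $\xi,\eta,\zeta\in V$: (0) For $g$ near $e$, $\mathfrak g=V\oplus\mathrm{Ad}_g\mathfrak h$ and $a''_g(\xi,\eta)=-\frac12\Pi''_g[\xi,\eta]$, where $\Pi''_g$ also denotes the linear projection on $V$ parallel to $\mathrm{Ad}_g\mathfrak h$. For $u\in Q$ near $e$, $d\Psi_u|_e$ is injective, $\mathfrak g=T_eQ'_u\oplus\mathrm{Ad}_u\mathfrak h$ with $T_eQ'_u=d\Psi_u|_e(V)$, and $\tilde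 a_u(\xi,\eta)=-\frac12(d\Psi_u|_e)^{-1}\widetilde\Pi_u[d\Psi_u|_e\xi,d\Psi_u|_e\eta]$, where $\widetilde\Pi_u$ is the linear projection on $T_eQ'_u$ parallel to $\mathrm{Ad}_u\mathfrak h$. Moreover $d\Psi_u|_e\,\xi=\xi+\frac12[u,\xi]+\frac12\Pi[u,\xi]+2R(u,\xi)+o(u)$ as $u\to0$ in $V$. (I) $$\overset2\nabla_la^i_{jk}\xi^j\eta^k\zeta^l=\frac{d}{dt}\Big|_{t=0}a''_{g_t}(\xi,\eta)=-\tfrac12\Pi[[\xi,\eta],\zeta]+\tfrac12\Pi[\Pi[\xi,\eta],\zeta],$$ both for $g_t=\exp(t\zeta)$ and for $g_t=\exp(t\zeta+\varphi(t\zeta))\in Q$; and $\overset2\nabla_la^i_{jk}=b^i_{[jk]l}$, i.e. the left side equals $\frac12(b(\xi,\eta,\zeta)-b(\eta,\xi,\zeta))$. (II) With $u_t\in Q$ the point of coordinate $t\zeta$, $$\overset1\nabla_la^i_{jk}\xi^j\eta^k\zeta^l=\frac{d}{dt}\Big|_{t=0}\tilde a_{u_t}(\xi,\eta)=-\tfrac14\Pi[[\xi,\zeta],\eta]+\tfrac14\Pi[\Pi[\xi,\zeta],\eta]-\Pi[R(\xi,\zeta),\eta]+\tfrac14\Pi[[\eta,\zeta],\xi]-\tfrac14\Pi[\Pi[\eta,\zeta],\xi]+\Pi[R(\eta,\zeta),\xi];$$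 and $\overset1\nabla_la^i_{jk}=b^i_{[j|l|k]}$, i.e. the left side equals $\frac12(b(\xi,\zeta,\eta)-b(\eta,\zeta,\xi))$. All the derivatives exist. -/

import Mathlib

open Filter Topology
open scoped ContDiff

noncomputable section

/-! ### Local Lie groups -/

/-- A local Lie group, written in a chart that sends the identity to `0`.  All axioms are required
only near the identity; values of `mul` and `inv` far away are irrelevant. -/
structure LocalLieGroup (𝔤 : Type*) [NormedAddCommGroup 𝔤] [NormedSpace ℝ 𝔤] where
  mul : 𝔤 → 𝔤 → 𝔤
  inv : 𝔤 → 𝔤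
  smooth_mul : ∀ᶠ p in 𝓝 (0 : 𝔤 × 𝔤), ContDiffAt ℝ ∞ (fun q : 𝔤 × 𝔤 => mul q.1 q.2) p
  smooth_inv : ∀ᶠ x in 𝓝 (0 : 𝔤), ContDiffAt ℝ ∞ inv x
  one_mul : ∀ᶠ x in 𝓝 (0 : 𝔤), mul 0 x = x
  mul_one : ∀ᶠ x in 𝓝 (0 : 𝔤), mul x 0 = x
  mul_assoc : ∀ᶠ p in 𝓝 (0 : 𝔤 × 𝔤 × 𝔤), mul (mul p.1 p.2.1) p.2.2 = mul p.1 (mul p.2.1 p.2.2)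
  inv_zero : inv 0 = 0
  mul_inv : ∀ᶠ x in 𝓝 (0 : 𝔤), mul x (inv x) = 0
  inv_mul : ∀ᶠ x in 𝓝 (0 : 𝔤), mul (inv x) x = 0

namespace LocalLieGroup

variable {𝔤 : Type*} [NormedAddCommGroup 𝔤] [NormedSpace ℝ 𝔤] (G : LocalLieGroup 𝔤)

/-- The left-invariant vector field with value `x` at the identity. -/
def leftInvariantField (x : 𝔤) : 𝔤 → 𝔤 := fun g => fderiv ℝ (fun h => G.mul g h) 0 x

/-- The Lie bracket on the tangent space at the identity. -/
def bracket (x y : 𝔤) : 𝔤 :=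
  VectorField.lieBracket ℝ (G.leftInvariantField x) (G.leftInvariantField y) 0

/-- The chart is the one given by the exponential map (normal coordinates, i.e. canonical
coordinates of the first kind): the straight lines through `0` are the one-parameter subgroups.
In such a chart the exponential map is the identity map of `𝔤`. -/
def IsNormal : Prop :=
  ∀ᶠ x in 𝓝 (0 : 𝔤), ∀ s ∈ Set.Icc (-1 : ℝ) 1, ∀ t ∈ Set.Icc (-1 : ℝ) 1,
    G.mul (s • x) (t • x) = (s + t) • x

/-- In normal coordinates: near the identity, `exp 𝔥` is a local subgroup of `G` (stability under
inverses is automatic since `exp (-h)` is the inverse of `exp h`). -/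
def IsLocalSubgroup (𝔥 : Submodule ℝ 𝔤) : Prop :=
  ∀ᶠ p in 𝓝 (0 : 𝔥 × 𝔥), G.mul (p.1 : 𝔤) (p.2 : 𝔤) ∈ 𝔥

/-- Conjugation `h ↦ g h g⁻¹`. -/
def conj (g h : 𝔤) : 𝔤 := G.mul (G.mul g h) (G.inv g)

/-- The adjoint action of `g` on `𝔤`. -/
def Ad (g : 𝔤) : 𝔤 →L[ℝ] 𝔤 := fderiv ℝ (G.conj g) 0

variable {V 𝔥 : Submodule ℝ 𝔤}

/-- Let `s : V → G` parametrise a submanifold through the identity and `k : 𝔥 → G` a local subgroup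
transversal to it.  `cosetProj s k` is the projection of `G` on the submanifold parallel to the
subgroup, in the parameter `V`: it sends `s x · k h` to `x`.  This determines it near the identity,
because `(x, h) ↦ s x · k h` is a local diffeomorphism at `(0, 0)`. -/
def cosetProj (s : V → 𝔤) (k : 𝔥 → 𝔤) : 𝔤 → V :=
  Classical.epsilon fun π : 𝔤 → V => ∀ᶠ p in 𝓝 (0 : V × 𝔥), π (G.mul (s p.1) (k p.2)) = p.1

/-- The local loop of the section parametrised by `s`, with respect to the subgroup parametrised by
`k`: multiply in `G` and project on the section parallel to the subgroup. -/
def cosetLoop (s : V → 𝔤) (k : 𝔥 → 𝔤) : V → V → V :=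
  fun x y => G.cosetProj s k (G.mul (s x) (s y))

end LocalLieGroup

section Sections

variable {𝔤 : Type*} [NormedAddCommGroup 𝔤] [NormedSpace ℝ 𝔤] {V 𝔥 : Submodule ℝ 𝔤}

/-- The parametrisation `ξ ↦ exp (ξ + φ ξ)` of the section `Q`, in normal coordinates. -/
def sectionMap (φ : V → 𝔥) : V → 𝔤 := fun ξ => (ξ : 𝔤) + (φ ξ : 𝔤)

/-- The bilinear symmetric map `R` in the expansion `φ ξ = R (ξ, ξ) + S (ξ, ξ, ξ) + o(3)`. -/
def quadraticPart (φ : V → 𝔥) (ξ η : V) : 𝔥 := (1 / 2 : ℝ) • fderiv ℝ (fderiv ℝ φ) 0 ξ η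

open Classical in
/-- The linear projection of `𝔤` on `A` parallel to `B` (for complementary `A`, `B`). -/
def projAlong (A B : Submodule ℝ 𝔤) : 𝔤 → 𝔤 :=
  fun w => if h : IsCompl A B then (A.projectionOnto B h w : 𝔤) else 0

end Sections

/-! ### The three-web of a local loop and its Chern connection

`E` is a chart domain of the loop centred at the neutral element, `m` the loop multiplication.
The web lives on a neighbourhood of `(0, 0)` in `E × E`; its foliations are `x = const`, `y = const`
and `m x y = const`. -/
section Web

variable {E : Type*} [NormedAddCommGroup E] [NormedSpace ℝ E] (m : E → E → E)

/-- The matrix `P = ∂m/∂x`; the first coframe form is `ω₁ = P dx`. -/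
def webP (p : E × E) : E →L[ℝ] E := fderiv ℝ (fun x => m x p.2) p.1

/-- The matrix `Q = ∂m/∂y`; the second coframe form is `ω₂ = Q dy`. -/
def webQ (p : E × E) : E →L[ℝ] E := fderiv ℝ (fun y => m p.1 y) p.2

/-- The mixed second derivative `∂²m/∂x∂y` in the directions `X`, `Y`. -/
def mixedDeriv (p : E × E) (X Y : E) : E :=
  fderiv ℝ (fun y => fderiv ℝ (fun x => m x y) p.1 X) p.2 Y

/-- The connection coefficients `Γᵏᵢⱼ ξⁱ ηʲ = -(∂²mᵏ/∂xᵅ∂yᵝ) (P⁻¹ ξ)ᵅ (Q⁻¹ η)ᵝ`. -/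
def chernGamma (p : E × E) (ξ η : E) : E :=
  -mixedDeriv m p ((webP m p).inverse ξ) ((webQ m p).inverse η)

/-- The Chern connection form `ωᵏⱼ = Γᵏᵢⱼ ω₁ⁱ + Γᵏⱼₗ ω₂ˡ`, evaluated on the tangent vector `X` and
applied to `ξ ∈ E`. -/
def chernForm (p X : E × E) (ξ : E) : E :=
  chernGamma m p (webP m p X.1) ξ + chernGamma m p ξ (webQ m p X.2)

/-- The torsion tensor field `aᵏᵢⱼ ξⁱ ηʲ` of the web:
`aᵏᵢⱼ = -½ (∂²mᵏ/∂xᵅ∂yᵝ) (P̃ᵅᵢ Q̃ᵝⱼ - P̃ᵅⱼ Q̃ᵝᵢ)`. -/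
def chernTorsion (p : E × E) (ξ η : E) : E :=
  -((1 / 2 : ℝ) •
    (mixedDeriv m p ((webP m p).inverse ξ) ((webQ m p).inverse η)
      - mixedDeriv m p ((webP m p).inverse η) ((webQ m p).inverse ξ)))

/-- The curvature two-form `Ωᵏⱼ = dωᵏⱼ - ωⁱⱼ ∧ ωᵏᵢ`, evaluated on `X`, `Y` and applied to `ξ`. -/
def chernCurvatureForm (p X Y : E × E) (ξ : E) : E :=
  fderiv ℝ (fun q => chernForm m q Y ξ) p X - fderiv ℝ (fun q => chernForm m q X ξ) p Y
    + chernForm m p X (chernForm m p Y ξ) - chernForm m p Y (chernForm m p X ξ)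

/-- The curvature tensor field `bᵏⱼₗₘ ξʲ ηˡ ζᵐ` of the web, defined by
`dωᵏⱼ = ωⁱⱼ ∧ ωᵏᵢ + bᵏⱼₗₘ ω₁ˡ ∧ ω₂ᵐ`. -/
def chernCurvature (p : E × E) (ξ η ζ : E) : E :=
  chernCurvatureForm m p ((webP m p).inverse η, 0) (0, (webQ m p).inverse ζ) ξ

/-- The covariant derivative of the torsion field in the direction `X`:
`∇aᵏᵢⱼ = daᵏᵢⱼ + aˡᵢⱼ ωᵏₗ - aᵏₗⱼ ωˡᵢ - aᵏᵢₗ ωˡⱼ`. -/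
def covDerivTorsion (p X : E × E) (ξ η : E) : E :=
  fderiv ℝ (fun q => chernTorsion m q ξ η) p X + chernForm m p X (chernTorsion m p ξ η)
    - chernTorsion m p (chernForm m p X ξ) η - chernTorsion m p ξ (chernForm m p X η)

/-- `∇¹ₗ aⁱⱼₖ ξʲ ηᵏ ζˡ`, where `∇a = ∇¹ₗ a ω₁ˡ + ∇²ₗ a ω₂ˡ`. -/
def nablaOneTorsion (p : E × E) (ξ η ζ : E) : E :=
  covDerivTorsion m p ((webP m p).inverse ζ, 0) ξ η

/-- `∇²ₗ aⁱⱼₖ ξʲ ηᵏ ζˡ`, where `∇a = ∇¹ₗ a ω₁ˡ + ∇²ₗ a ω₂ˡ`. -/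
def nablaTwoTorsion (p : E × E) (ξ η ζ : E) : E :=
  covDerivTorsion m p (0, (webQ m p).inverse ζ) ξ η

end Web

/-! ### The loop of a section and the conjugated-subgroup loops -/
namespace LocalLieGroup

variable {𝔤 : Type*} [NormedAddCommGroup 𝔤] [NormedSpace ℝ 𝔤] (G : LocalLieGroup 𝔤)
  {V 𝔥 : Submodule ℝ 𝔤} (φ : V → 𝔥)

/-- The loop `x × y = Π_Q (x y)` on the section `Q` of `G mod H`, in the coordinate `V` of `Q`. -/
def sectionLoop : V → V → V := G.cosetLoop (sectionMap φ) (fun h : 𝔥 => (h : 𝔤))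

/-- The torsion tensor `a''_g` at the neutral element of the loop `(x, y) ↦ Π''_g (x y)` on `Q`,
where `Π''_g` is the projection on `Q` parallel to the conjugated subgroup `g H g⁻¹`. -/
def torsionTwo (g : 𝔤) (ξ η : V) : V :=
  chernTorsion (G.cosetLoop (sectionMap φ) (fun h : 𝔥 => G.conj g (h : 𝔤))) 0 ξ η

/-- The map `Ψ_u x = (u × x) u⁻¹` from `Q` to the section `Q'_u = Q u⁻¹`; here `u`, `x` are given
by their coordinates in `V`. -/
def psi (u x : V) : 𝔤 :=
  G.mul (sectionMap φ (G.sectionLoop φ u x)) (G.inv (sectionMap φ u))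

/-- The differential of `Ψ_u` at the neutral element. -/
def dPsi (u : V) : V →L[ℝ] 𝔤 := fderiv ℝ (G.psi φ u) 0

/-- The torsion tensor `ã_u` at the neutral element of the loop `(a, b) ↦ Π'_u (a b)` on `Q'_u`,
where `Π'_u` is the projection on `Q'_u` parallel to `u H u⁻¹`, transported to `Q` by `Ψ_u`. -/
def torsionOne (u : V) (ξ η : V) : V :=
  chernTorsion (G.cosetLoop (G.psi φ u) (fun h : 𝔥 => G.conj (sectionMap φ u) (h : 𝔤))) 0 ξ η

end LocalLieGroup

end

/-! Everything is a computation with Taylor coefficients of order at most three at the neutral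
element. For any `C³` local loop the normalisation `m x 0 = x`, `m 0 y = y` makes the first
derivative the sum and kills the pure second derivatives. Torsion, curvature and the two covariant
derivatives at the origin are then expressed by the mixed coefficient `loopM` and by third
derivatives of types xxy and xyy. The identities with the curvature follow from symmetry of third
derivatives alone and hold for every such loop.

For the coset loop, `m x y` is the left action of `G` on the section with the group argument
restricted to the section. The law `(a b) y = a (b y)` at third order
(`IsLocalLoop.thirdFDeriv_action`) compares the derivative of the action with two group directions
to the one with two section directions. Each covariant derivative of the torsion contains a
difference in which one of the two types cancels by symmetry, so only second derivatives of the
action survive. Those come from the factorisation `a · s y = s (a y) · k h`, differentiated twice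
and projected along `𝔥` (`exists_secondFDeriv_cosetAction`). The quadratic part of `φ` enters only
the first covariant derivative, through the second derivative of the section in a group argument.

On the other side, the torsion of a coset loop at the neutral element is minus half the bracket
projected along the tangent space of the subgroup (`chernTorsion_cosetLoop`); this needs only
transversality, so it applies to the conjugated subgroups and to the moved sections. Its derivative
in the parameter is that of `T⁻¹ w` for a family `T` of splittings, computed from `Ad' = bracket`
and the first-order expansion of `dPsi`. The two sides then agree by linear algebra, with the Jacobi
identity needed only for the first covariant derivative. -/

/-! ### Calculus of second and third derivatives. -/

section HigherDerivatives

variable {E F G : Type*} [NormedAddCommGroup E] [NormedSpace ℝ E] [NormedAddCommGroup F]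
  [NormedSpace ℝ F] [NormedAddCommGroup G] [NormedSpace ℝ G]

/-- The second derivative as a bilinear map. -/
noncomputable def secondFDeriv (f : E → F) (x : E) : E →L[ℝ] E →L[ℝ] F :=
  fderiv ℝ (fderiv ℝ f) x

/-- The third derivative as a trilinear map. -/
noncomputable def thirdFDeriv (f : E → F) (x : E) : E →L[ℝ] E →L[ℝ] E →L[ℝ] F :=
  fderiv ℝ (secondFDeriv f) x

variable {f : E → F} {x : E}

lemma ContDiffAt.eventually_contDiffAt {n : ℕ} (hf : ContDiffAt ℝ n f x) :
    ∀ᶠ y in 𝓝 x, ContDiffAt ℝ n f y :=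
  hf.eventually (by simp)

lemma ContDiffAt.comp_at_eq {n : WithTop ℕ∞} {g : F → G} {y : F} (hg : ContDiffAt ℝ n g y)
    (hf : ContDiffAt ℝ n f x) (h : f x = y) : ContDiffAt ℝ n (fun z => g (f z)) x := by
  subst h; exact hg.comp x hf

lemma ContDiffAt.hasFDerivAt_fderiv (hf : ContDiffAt ℝ 2 f x) :
    HasFDerivAt (fderiv ℝ f) (secondFDeriv f x) x :=
  ((hf.fderiv_right (m := 1) (by norm_num)).differentiableAt (by norm_num)).hasFDerivAt

lemma ContDiffAt.contDiffAt_secondFDeriv (hf : ContDiffAt ℝ 3 f x) :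
    ContDiffAt ℝ 1 (secondFDeriv f) x :=
  (hf.fderiv_right (m := 2) (by norm_num)).fderiv_right (m := 1) (by norm_num)

lemma ContDiffAt.hasFDerivAt_secondFDeriv (hf : ContDiffAt ℝ 3 f x) :
    HasFDerivAt (secondFDeriv f) (thirdFDeriv f x) x :=
  (hf.contDiffAt_secondFDeriv.differentiableAt (by norm_num)).hasFDerivAt

lemma ContDiffAt.secondFDeriv_symm (hf : ContDiffAt ℝ 2 f x) (v w : E) :
    secondFDeriv f x v w = secondFDeriv f x w v :=
  (hf.isSymmSndFDerivAt (by simp)) v w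

lemma ContDiffAt.thirdFDeriv_symm_left (hf : ContDiffAt ℝ 3 f x) (u v w : E) :
    thirdFDeriv f x u v w = thirdFDeriv f x v u w := by
  have h := (hf.fderiv_right (m := 2) (by norm_num)).secondFDeriv_symm u v
  exact congrArg (fun T : E →L[ℝ] F => T w) h

/-- The second derivative is symmetric at every nearby point, so its symmetry can be differentiated
once more. -/
lemma ContDiffAt.thirdFDeriv_symm_right (hf : ContDiffAt ℝ 3 f x) (u v w : E) :
    thirdFDeriv f x u v w = thirdFDeriv f x u w v := by
  have h : (fun y => secondFDeriv f y v w) =ᶠ[𝓝 x] fun y => secondFDeriv f y w v := by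
    filter_upwards [hf.eventually_contDiffAt (n := 3)] with y hy
    exact (hy.of_le (by norm_num)).secondFDeriv_symm v w
  have h3 := hf.hasFDerivAt_secondFDeriv
  have h1 := (h3.clm_apply (hasFDerivAt_const v x)).clm_apply (hasFDerivAt_const w x)
  have h2 := (h3.clm_apply (hasFDerivAt_const w x)).clm_apply (hasFDerivAt_const v x)
  have := congrArg (fun T : E →L[ℝ] F => T u) ((h1.congr_of_eventuallyEq h.symm).unique h2)
  simpa using this

lemma Filter.EventuallyEq.secondFDeriv_eq {g : E → F} (h : f =ᶠ[𝓝 x] g) :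
    secondFDeriv f x = secondFDeriv g x :=
  h.fderiv.fderiv_eq

lemma Filter.EventuallyEq.thirdFDeriv_eq {g : E → F} (h : f =ᶠ[𝓝 x] g) :
    thirdFDeriv f x = thirdFDeriv g x :=
  h.fderiv.fderiv.fderiv_eq

lemma ContinuousLinearMap.secondFDeriv_eq_zero (L : E →L[ℝ] F) (x : E) :
    secondFDeriv L x = 0 := by
  have : fderiv ℝ (L : E → F) = fun _ => L := by ext1 y; exact L.fderiv
  rw [secondFDeriv, this]; simp

lemma ContinuousLinearMap.thirdFDeriv_eq_zero (L : E →L[ℝ] F) (x : E) :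
    thirdFDeriv L x = 0 := by
  have : secondFDeriv (L : E → F) = fun _ => 0 := by ext1 y; exact L.secondFDeriv_eq_zero y
  rw [thirdFDeriv, this]; simp

lemma fderiv_comp_apply {g : F → G} (hg : ContDiffAt ℝ 1 g (f x)) (hf : ContDiffAt ℝ 1 f x)
    (v : E) : fderiv ℝ (fun y => g (f y)) x v = fderiv ℝ g (f x) (fderiv ℝ f x v) := by
  rw [show (fun y => g (f y)) = g ∘ f from rfl,
    fderiv_comp x (hg.differentiableAt (by norm_num)) (hf.differentiableAt (by norm_num))]
  rfl

lemma secondFDeriv_comp_apply {g : F → G} (hg : ContDiffAt ℝ 2 g (f x)) (hf : ContDiffAt ℝ 2 f x)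
    (v w : E) : secondFDeriv (fun y => g (f y)) x v w
      = secondFDeriv g (f x) (fderiv ℝ f x v) (fderiv ℝ f x w)
        + fderiv ℝ g (f x) (secondFDeriv f x v w) := by
  have he : (fun y => fderiv ℝ (fun z => g (f z)) y w)
      =ᶠ[𝓝 x] fun y => fderiv ℝ g (f y) (fderiv ℝ f y w) := by
    filter_upwards [hf.eventually_contDiffAt (n := 2),
      hf.continuousAt.eventually (hg.eventually_contDiffAt (n := 2))] with y hy hgy
    exact fderiv_comp_apply (hgy.of_le (by norm_num)) (hy.of_le (by norm_num)) w
  have hgf : ContDiffAt ℝ 2 (fun y => g (f y)) x := hg.comp x hf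
  have h1 := hgf.hasFDerivAt_fderiv.clm_apply (hasFDerivAt_const w x)
  have h2 := (hg.hasFDerivAt_fderiv.comp x
    (hf.differentiableAt (by norm_num)).hasFDerivAt).clm_apply
    (hf.hasFDerivAt_fderiv.clm_apply (hasFDerivAt_const w x))
  have := congrArg (fun T : E →L[ℝ] G => T v) ((h1.congr_of_eventuallyEq he.symm).unique h2)
  simpa [add_comm] using this

lemma thirdFDeriv_comp_apply {g : F → G} (hg : ContDiffAt ℝ 3 g (f x)) (hf : ContDiffAt ℝ 3 f x)
    (u v w : E) : thirdFDeriv (fun y => g (f y)) x u v w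
      = thirdFDeriv g (f x) (fderiv ℝ f x u) (fderiv ℝ f x v) (fderiv ℝ f x w)
        + secondFDeriv g (f x) (secondFDeriv f x u v) (fderiv ℝ f x w)
        + secondFDeriv g (f x) (fderiv ℝ f x v) (secondFDeriv f x u w)
        + secondFDeriv g (f x) (fderiv ℝ f x u) (secondFDeriv f x v w)
        + fderiv ℝ g (f x) (thirdFDeriv f x u v w) := by
  have he : (fun y => secondFDeriv (fun z => g (f z)) y v w)
      =ᶠ[𝓝 x] fun y => secondFDeriv g (f y) (fderiv ℝ f y v) (fderiv ℝ f y w)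
        + fderiv ℝ g (f y) (secondFDeriv f y v w) := by
    filter_upwards [hf.eventually_contDiffAt (n := 3),
      hf.continuousAt.eventually (hg.eventually_contDiffAt (n := 3))] with y hy hgy
    exact secondFDeriv_comp_apply (hgy.of_le (by norm_num)) (hy.of_le (by norm_num)) v w
  have hgf : ContDiffAt ℝ 3 (fun y => g (f y)) x := hg.comp x hf
  have hf2 : ContDiffAt ℝ 2 f x := hf.of_le (by norm_num)
  have hg2 : ContDiffAt ℝ 2 g (f x) := hg.of_le (by norm_num)
  have hf' := (hf.differentiableAt (by norm_num)).hasFDerivAt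
  have h1 := (hgf.hasFDerivAt_secondFDeriv.clm_apply (hasFDerivAt_const v x)).clm_apply
    (hasFDerivAt_const w x)
  have h2 := (((hg.hasFDerivAt_secondFDeriv.comp x hf').clm_apply
    (hf2.hasFDerivAt_fderiv.clm_apply (hasFDerivAt_const v x))).clm_apply
    (hf2.hasFDerivAt_fderiv.clm_apply (hasFDerivAt_const w x))).add
    ((hg2.hasFDerivAt_fderiv.comp x hf').clm_apply
      ((hf.hasFDerivAt_secondFDeriv.clm_apply (hasFDerivAt_const v x)).clm_apply
        (hasFDerivAt_const w x)))
  have := congrArg (fun T : E →L[ℝ] G => T u) ((h1.congr_of_eventuallyEq he.symm).unique h2)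
  simp at this
  rw [this]; abel

lemma secondFDeriv_comp_clm (L : G →L[ℝ] E) {y : G} (hf : ContDiffAt ℝ 2 f x) (hx : L y = x)
    (v w : G) : secondFDeriv (fun z => f (L z)) y v w = secondFDeriv f x (L v) (L w) := by
  subst hx
  simpa [L.secondFDeriv_eq_zero] using secondFDeriv_comp_apply hf (L.contDiff.contDiffAt (x := y)) v w

lemma thirdFDeriv_comp_clm (L : G →L[ℝ] E) {y : G} (hf : ContDiffAt ℝ 3 f x) (hx : L y = x)
    (u v w : G) :
    thirdFDeriv (fun z => f (L z)) y u v w = thirdFDeriv f x (L u) (L v) (L w) := by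
  subst hx
  simpa [L.secondFDeriv_eq_zero, L.thirdFDeriv_eq_zero] using
    thirdFDeriv_comp_apply hf (L.contDiff.contDiffAt (x := y)) u v w

lemma secondFDeriv_clm_comp (L : F →L[ℝ] G) (hf : ContDiffAt ℝ 2 f x) (v w : E) :
    secondFDeriv (fun z => L (f z)) x v w = L (secondFDeriv f x v w) := by
  simpa [L.secondFDeriv_eq_zero] using secondFDeriv_comp_apply (L.contDiff.contDiffAt) hf v w

lemma thirdFDeriv_clm_comp (L : F →L[ℝ] G) (hf : ContDiffAt ℝ 3 f x) (u v w : E) :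
    thirdFDeriv (fun z => L (f z)) x u v w = L (thirdFDeriv f x u v w) := by
  simpa [L.secondFDeriv_eq_zero, L.thirdFDeriv_eq_zero] using
    thirdFDeriv_comp_apply (L.contDiff.contDiffAt) hf u v w

lemma fderiv_prodMk_apply {g : E → G} (hf : ContDiffAt ℝ 1 f x) (hg : ContDiffAt ℝ 1 g x) (v : E) :
    fderiv ℝ (fun y => (f y, g y)) x v = (fderiv ℝ f x v, fderiv ℝ g x v) := by
  rw [(hf.differentiableAt (by norm_num)).fderiv_prodMk (hg.differentiableAt (by norm_num))]
  rfl

lemma secondFDeriv_prodMk_apply {g : E → G} (hf : ContDiffAt ℝ 2 f x) (hg : ContDiffAt ℝ 2 g x)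
    (v w : E) : secondFDeriv (fun y => (f y, g y)) x v w
      = (secondFDeriv f x v w, secondFDeriv g x v w) := by
  have h := hf.prodMk hg
  refine Prod.ext ?_ ?_
  · exact (secondFDeriv_clm_comp (ContinuousLinearMap.fst ℝ F G) h v w).symm
  · exact (secondFDeriv_clm_comp (ContinuousLinearMap.snd ℝ F G) h v w).symm

lemma thirdFDeriv_prodMk_apply {g : E → G} (hf : ContDiffAt ℝ 3 f x) (hg : ContDiffAt ℝ 3 g x)
    (u v w : E) : thirdFDeriv (fun y => (f y, g y)) x u v w
      = (thirdFDeriv f x u v w, thirdFDeriv g x u v w) := by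
  have h := hf.prodMk hg
  refine Prod.ext ?_ ?_
  · exact (thirdFDeriv_clm_comp (ContinuousLinearMap.fst ℝ F G) h u v w).symm
  · exact (thirdFDeriv_clm_comp (ContinuousLinearMap.snd ℝ F G) h u v w).symm

/-- The derivative of `y ↦ (T y)⁻¹ w` at a point where `T` is invertible. -/
lemma HasFDerivAt.inverse_apply [CompleteSpace E] {T : G → E →L[ℝ] F} {T' : G →L[ℝ] E →L[ℝ] F}
    {y : G} (hT : HasFDerivAt T T' y) (e : E ≃L[ℝ] F) (he : T y = e) {w : G → F}
    {w' : G →L[ℝ] F} (hw : HasFDerivAt w w' y) :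
    ∃ S : G →L[ℝ] E, HasFDerivAt (fun z => (T z).inverse (w z)) S y ∧
      ∀ v, S v = e.symm (w' v - T' v (e.symm (w y))) := by
  -- Inversion of operators is smooth at an invertible operator; this is where completeness is used.
  have hd : DifferentiableAt ℝ (fun z => (T z).inverse) y := by
    have h1 : ContDiffAt ℝ 1 ContinuousLinearMap.inverse (T y) := he ▸ contDiffAt_map_inverse e
    exact (h1.differentiableAt (by norm_num)).comp y hT.differentiableAt
  have h := hd.hasFDerivAt.clm_apply hw
  refine ⟨_, h, fun v => ?_⟩
  -- Invertibility is an open condition, so this identity holds near `y`; differentiating it and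
  -- solving for the unknown derivative gives the formula.
  have hinv : ∀ᶠ z in 𝓝 y, T z ((T z).inverse (w z)) = w z := by
    have : ∀ᶠ z in 𝓝 y, T z ∈ Set.range ((↑) : (E ≃L[ℝ] F) → E →L[ℝ] F) :=
      hT.continuousAt.eventually (he ▸ e.nhds)
    filter_upwards [this] with z ⟨ez, hz⟩
    simp [← hz]
  have h2 := ((hT.clm_apply h).congr_of_eventuallyEq (EventuallyEq.symm hinv)).unique hw
  have h3 := congrArg (fun S : G →L[ℝ] F => e.symm (S v)) h2
  simp only [he, ContinuousLinearMap.inverse_equiv] at h3 ⊢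
  rw [map_sub, ← h3]
  simp
end HigherDerivatives

/-! ### The Chern connection of a local loop at its neutral element. -/

section NeutralWeb

variable {E : Type*} [NormedAddCommGroup E] [NormedSpace ℝ E] {m : E → E → E}

lemma fderiv_partial_left {E F G : Type*} [NormedAddCommGroup E] [NormedSpace ℝ E]
    [NormedAddCommGroup F] [NormedSpace ℝ F] [NormedAddCommGroup G] [NormedSpace ℝ G]
    {f : E → F → G} {p : E × F}
    (hf : DifferentiableAt ℝ (fun q : E × F => f q.1 q.2) p) (X : E) :
    fderiv ℝ (fun x => f x p.2) p.1 X = fderiv ℝ (fun q : E × F => f q.1 q.2) p (X, 0) := by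
  have h := hf.hasFDerivAt.comp (f := fun x => (x, p.2)) p.1 (hasFDerivAt_prodMk_left p.1 p.2)
  exact congrArg (fun T : E →L[ℝ] G => T X) h.fderiv

lemma fderiv_partial_right {E F G : Type*} [NormedAddCommGroup E] [NormedSpace ℝ E]
    [NormedAddCommGroup F] [NormedSpace ℝ F] [NormedAddCommGroup G] [NormedSpace ℝ G]
    {f : E → F → G} {p : E × F}
    (hf : DifferentiableAt ℝ (fun q : E × F => f q.1 q.2) p) (Y : F) :
    fderiv ℝ (fun y => f p.1 y) p.2 Y = fderiv ℝ (fun q : E × F => f q.1 q.2) p (0, Y) := by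
  have h := hf.hasFDerivAt.comp (f := fun y => (p.1, y)) p.2 (hasFDerivAt_prodMk_right p.1 p.2)
  exact congrArg (fun T : F →L[ℝ] G => T Y) h.fderiv

lemma mixedDeriv_eq {p : E × E} (hm : ContDiffAt ℝ 2 (fun q : E × E => m q.1 q.2) p) (X Y : E) :
    mixedDeriv m p X Y = secondFDeriv (fun q : E × E => m q.1 q.2) p (X, 0) (0, Y) := by
  have hc : ContinuousAt (fun y => (p.1, y)) p.2 := by fun_prop
  have he : (fun y => fderiv ℝ (fun x => m x y) p.1 X)
      =ᶠ[𝓝 p.2] fun y => fderiv ℝ (fun q : E × E => m q.1 q.2) (p.1, y) (X, 0) := by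
    filter_upwards [hc.eventually (hm.eventually_contDiffAt (n := 2))] with y hy
    exact fderiv_partial_left (p := (p.1, y)) (hy.differentiableAt (by norm_num)) X
  have h1 := (hm.hasFDerivAt_fderiv.comp (f := fun y => (p.1, y)) p.2
    (hasFDerivAt_prodMk_right p.1 p.2)).clm_apply (hasFDerivAt_const (X, (0 : E)) p.2)
  rw [mixedDeriv, (h1.congr_of_eventuallyEq he).fderiv, hm.secondFDeriv_symm]
  simp

/-- A local loop of class `C³` with neutral element `0`. -/
structure IsLocalLoop (m : E → E → E) : Prop where
  contDiffAt : ContDiffAt ℝ 3 (fun q : E × E => m q.1 q.2) 0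
  right_neutral : ∀ᶠ x in 𝓝 (0 : E), m x 0 = x
  left_neutral : ∀ᶠ y in 𝓝 (0 : E), m 0 y = y

namespace IsLocalLoop

variable (hm : IsLocalLoop m)

include hm

lemma contDiffAt_two : ContDiffAt ℝ 2 (fun q : E × E => m q.1 q.2) 0 :=
  hm.contDiffAt.of_le (by norm_num)

lemma right_comp : (fun x : E => (fun q : E × E => m q.1 q.2) (ContinuousLinearMap.inl ℝ E E x))
    =ᶠ[𝓝 0] ContinuousLinearMap.id ℝ E := by
  filter_upwards [hm.right_neutral] with x hx
  simpa using hx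

lemma left_comp : (fun x : E => (fun q : E × E => m q.1 q.2) (ContinuousLinearMap.inr ℝ E E x))
    =ᶠ[𝓝 0] ContinuousLinearMap.id ℝ E := by
  filter_upwards [hm.left_neutral] with x hx
  simpa using hx

lemma fderiv_left (X : E) : fderiv ℝ (fun q : E × E => m q.1 q.2) 0 (X, 0) = X := by
  have h := fderiv_partial_left (f := m) (p := (0 : E × E))
    (hm.contDiffAt.differentiableAt (by norm_num)) X
  rw [← h]
  change fderiv ℝ (fun x => m x 0) 0 X = X
  rw [EventuallyEq.fderiv_eq (f := fun x => x) hm.right_neutral]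
  simp

lemma fderiv_right (X : E) : fderiv ℝ (fun q : E × E => m q.1 q.2) 0 (0, X) = X := by
  have h := fderiv_partial_right (f := m) (p := (0 : E × E))
    (hm.contDiffAt.differentiableAt (by norm_num)) X
  rw [← h]
  change fderiv ℝ (fun x => m 0 x) 0 X = X
  rw [EventuallyEq.fderiv_eq (f := fun x => x) hm.left_neutral]
  simp

lemma fderiv_zero (p : E × E) : fderiv ℝ (fun q : E × E => m q.1 q.2) 0 p = p.1 + p.2 := by
  conv_lhs => rw [show p = (p.1, 0) + (0, p.2) by simp, map_add, hm.fderiv_left, hm.fderiv_right]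

/-- On the axis `y = 0` the multiplication is the identity, a linear map. -/
lemma secondFDeriv_left (X Y : E) :
    secondFDeriv (fun q : E × E => m q.1 q.2) 0 (X, 0) (Y, 0) = 0 := by
  have h := secondFDeriv_comp_clm (f := fun q : E × E => m q.1 q.2)
    (ContinuousLinearMap.inl ℝ E E) (y := 0) hm.contDiffAt_two (by simp) X Y
  rw [hm.right_comp.secondFDeriv_eq, ContinuousLinearMap.secondFDeriv_eq_zero] at h
  simpa using h.symm

lemma secondFDeriv_right (X Y : E) :
    secondFDeriv (fun q : E × E => m q.1 q.2) 0 (0, X) (0, Y) = 0 := by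
  have h := secondFDeriv_comp_clm (f := fun q : E × E => m q.1 q.2)
    (ContinuousLinearMap.inr ℝ E E) (y := 0) hm.contDiffAt_two (by simp) X Y
  rw [hm.left_comp.secondFDeriv_eq, ContinuousLinearMap.secondFDeriv_eq_zero] at h
  simpa using h.symm

end IsLocalLoop

/-- The second mixed Taylor coefficient of a loop. -/
noncomputable def loopM (m : E → E → E) (x y : E) : E :=
  secondFDeriv (fun q : E × E => m q.1 q.2) 0 (x, 0) (0, y)

lemma webP_eq {p : E × E} (hm : DifferentiableAt ℝ (fun q : E × E => m q.1 q.2) p) :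
    webP m p = (fderiv ℝ (fun q : E × E => m q.1 q.2) p).comp (ContinuousLinearMap.inl ℝ E E) := by
  ext X; simpa [webP] using fderiv_partial_left (f := m) hm X

lemma webQ_eq {p : E × E} (hm : DifferentiableAt ℝ (fun q : E × E => m q.1 q.2) p) :
    webQ m p = (fderiv ℝ (fun q : E × E => m q.1 q.2) p).comp (ContinuousLinearMap.inr ℝ E E) := by
  ext X; simpa [webQ] using fderiv_partial_right (f := m) hm X

namespace IsLocalLoop

variable (hm : IsLocalLoop m)

include hm

lemma eventually_differentiableAt :
    ∀ᶠ p in 𝓝 (0 : E × E), DifferentiableAt ℝ (fun q : E × E => m q.1 q.2) p := by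
  filter_upwards [hm.contDiffAt.eventually_contDiffAt (n := 3)] with p hp
  exact hp.differentiableAt (by norm_num)

lemma webP_zero : webP m 0 = ContinuousLinearMap.id ℝ E := by
  rw [webP_eq hm.eventually_differentiableAt.self_of_nhds]
  ext X; simpa using hm.fderiv_left X

lemma webQ_zero : webQ m 0 = ContinuousLinearMap.id ℝ E := by
  rw [webQ_eq hm.eventually_differentiableAt.self_of_nhds]
  ext X; simpa using hm.fderiv_right X

/-- Since `P = id` at the origin, the derivative of `P⁻¹` is minus that of `P`; the x-direction
drops out because pure second derivatives vanish. -/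
lemma hasFDerivAt_webP_inverse [CompleteSpace E] (ξ : E) : ∃ S : E × E →L[ℝ] E,
    HasFDerivAt (fun p => (webP m p).inverse ξ) S 0 ∧ ∀ X Y, S (X, Y) = -loopM m ξ Y := by
  have hT := hm.contDiffAt_two.hasFDerivAt_fderiv.clm_comp
    (hasFDerivAt_const (ContinuousLinearMap.inl ℝ E E) (0 : E × E))
  obtain ⟨S, hS, hS'⟩ := hT.inverse_apply (ContinuousLinearEquiv.refl ℝ E)
    (by ext X; simpa using hm.fderiv_left X) (hasFDerivAt_const ξ (0 : E × E))
  refine ⟨S, hS.congr_of_eventuallyEq ?_, fun X Y => ?_⟩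
  · filter_upwards [hm.eventually_differentiableAt] with p hp
    simp [webP_eq hp]
  · have : ((X, Y) : E × E) = (X, 0) + (0, Y) := by simp
    rw [hS']
    simp only [this, map_add]
    simp [hm.secondFDeriv_left, loopM, hm.contDiffAt_two.secondFDeriv_symm (0, Y)]

lemma hasFDerivAt_webQ_inverse [CompleteSpace E] (ξ : E) : ∃ S : E × E →L[ℝ] E,
    HasFDerivAt (fun p => (webQ m p).inverse ξ) S 0 ∧ ∀ X Y, S (X, Y) = -loopM m X ξ := by
  have hT := hm.contDiffAt_two.hasFDerivAt_fderiv.clm_comp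
    (hasFDerivAt_const (ContinuousLinearMap.inr ℝ E E) (0 : E × E))
  obtain ⟨S, hS, hS'⟩ := hT.inverse_apply (ContinuousLinearEquiv.refl ℝ E)
    (by ext X; simpa using hm.fderiv_right X) (hasFDerivAt_const ξ (0 : E × E))
  refine ⟨S, hS.congr_of_eventuallyEq ?_, fun X Y => ?_⟩
  · filter_upwards [hm.eventually_differentiableAt] with p hp
    simp [webQ_eq hp]
  · have : ((X, Y) : E × E) = (X, 0) + (0, Y) := by simp
    rw [hS']
    simp only [this, map_add]
    simp [hm.secondFDeriv_right, loopM]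

/-- The derivative at the origin of the mixed second derivative along moving directions. -/
lemma hasFDerivAt_mixedDeriv {f g : E × E → E} {f' g' : E × E →L[ℝ] E}
    (hf : HasFDerivAt f f' 0) (hg : HasFDerivAt g g' 0) : ∃ S : E × E →L[ℝ] E,
    HasFDerivAt (fun p => mixedDeriv m p (f p) (g p)) S 0 ∧
      ∀ X, S X = thirdFDeriv (fun q : E × E => m q.1 q.2) 0 X (f 0, 0) (0, g 0)
        + loopM m (f' X) (g 0) + loopM m (f 0) (g' X) := by
  have h := (hm.contDiffAt.hasFDerivAt_secondFDeriv.clm_apply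
    ((ContinuousLinearMap.inl ℝ E E).hasFDerivAt.comp 0 hf)).clm_apply
    ((ContinuousLinearMap.inr ℝ E E).hasFDerivAt.comp 0 hg)
  refine ⟨_, h.congr_of_eventuallyEq ?_, fun X => ?_⟩
  · filter_upwards [hm.contDiffAt.eventually_contDiffAt (n := 3)] with p hp
    rw [mixedDeriv_eq (hp.of_le (by norm_num))]
    rfl
  · simp [loopM]; abel

omit hm in
lemma loopM_add_left (x x' y : E) : loopM m (x + x') y = loopM m x y + loopM m x' y := by
  have : ((x + x', 0) : E × E) = (x, 0) + (x', 0) := by simp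
  rw [loopM, this]; simp only [map_add]; rfl

omit hm in
lemma loopM_add_right (x y y' : E) : loopM m x (y + y') = loopM m x y + loopM m x y' := by
  have : ((0, y + y') : E × E) = (0, y) + (0, y') := by simp
  rw [loopM, this]; simp only [map_add]; rfl

omit hm in
lemma loopM_smul_left (c : ℝ) (x y : E) : loopM m (c • x) y = c • loopM m x y := by
  have : ((c • x, 0) : E × E) = c • (x, 0) := by simp
  rw [loopM, this]; simp only [map_smul]; rfl

omit hm in
lemma loopM_smul_right (c : ℝ) (x y : E) : loopM m x (c • y) = c • loopM m x y := by
  have : ((0, c • y) : E × E) = c • (0, y) := by simp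
  rw [loopM, this]; simp only [map_smul]; rfl

omit hm in
lemma loopM_neg_left (x y : E) : loopM m (-x) y = -loopM m x y := by
  simpa using loopM_smul_left (m := m) (-1) x y

omit hm in
lemma loopM_neg_right (x y : E) : loopM m x (-y) = -loopM m x y := by
  simpa using loopM_smul_right (m := m) (-1) x y

omit hm in
lemma loopM_zero_left (y : E) : loopM m 0 y = 0 := by simp [loopM, ← Prod.zero_eq_mk]

omit hm in
lemma loopM_zero_right (y : E) : loopM m y 0 = 0 := by simp [loopM, ← Prod.zero_eq_mk]

lemma mixedDeriv_zero (ξ η : E) : mixedDeriv m 0 ξ η = loopM m ξ η :=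
  mixedDeriv_eq hm.contDiffAt_two ξ η

lemma chernTorsion_zero (ξ η : E) :
    chernTorsion m 0 ξ η = -((1 / 2 : ℝ) • (loopM m ξ η - loopM m η ξ)) := by
  simp [chernTorsion, hm.webP_zero, hm.webQ_zero, hm.mixedDeriv_zero]

lemma chernForm_zero (X : E × E) (ξ : E) :
    chernForm m 0 X ξ = -loopM m X.1 ξ - loopM m ξ X.2 := by
  simp [chernForm, chernGamma, hm.webP_zero, hm.webQ_zero, hm.mixedDeriv_zero, sub_eq_add_neg]

variable [CompleteSpace E]

lemma fderiv_chernTorsion (ξ η X Y : E) :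
    fderiv ℝ (fun q => chernTorsion m q ξ η) 0 (X, Y) = -((1 / 2 : ℝ) •
      ((thirdFDeriv (fun q : E × E => m q.1 q.2) 0 (X, Y) (ξ, 0) (0, η)
          - loopM m (loopM m ξ Y) η - loopM m ξ (loopM m X η))
        - (thirdFDeriv (fun q : E × E => m q.1 q.2) 0 (X, Y) (η, 0) (0, ξ)
          - loopM m (loopM m η Y) ξ - loopM m η (loopM m X ξ)))) := by
  obtain ⟨P1, hP1, hP1'⟩ := hm.hasFDerivAt_webP_inverse ξ
  obtain ⟨P2, hP2, hP2'⟩ := hm.hasFDerivAt_webP_inverse η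
  obtain ⟨Q1, hQ1, hQ1'⟩ := hm.hasFDerivAt_webQ_inverse ξ
  obtain ⟨Q2, hQ2, hQ2'⟩ := hm.hasFDerivAt_webQ_inverse η
  obtain ⟨S1, hS1, hS1'⟩ := hm.hasFDerivAt_mixedDeriv hP1 hQ2
  obtain ⟨S2, hS2, hS2'⟩ := hm.hasFDerivAt_mixedDeriv hP2 hQ1
  have h := ((hS1.sub hS2).const_smul (1 / 2 : ℝ)).neg
  have h' : fderiv ℝ (fun q => chernTorsion m q ξ η) 0 = _ := h.fderiv
  rw [h']
  simp only [_root_.neg_apply, _root_.smul_apply,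
    _root_.sub_apply, hS1', hS2', hP1', hP2', hQ1', hQ2', hm.webP_zero, hm.webQ_zero,
    ContinuousLinearMap.inverse_id, ContinuousLinearMap.id_apply, loopM_neg_left, loopM_neg_right,
    ← sub_eq_add_neg]

/-- On a vector tangent to one factor, one of the two terms of the form vanishes, and in the other
`P⁻¹ P` (or `Q⁻¹ Q`) cancels. The direction `X` thus stays constant when the form is differentiated.
-/
lemma eventually_chernForm (X ξ : E) :
    (∀ᶠ p in 𝓝 (0 : E × E), chernForm m p (X, 0) ξ
      = -mixedDeriv m p X ((webQ m p).inverse ξ)) ∧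
    (∀ᶠ p in 𝓝 (0 : E × E), chernForm m p (0, X) ξ
      = -mixedDeriv m p ((webP m p).inverse ξ) X) := by
  -- The total `inverse` is a genuine inverse only at invertible operators, which form a
  -- neighbourhood of the identity.
  have hinv : ∀ T : E × E → E →L[ℝ] E, ContinuousAt T 0 → T 0 = ContinuousLinearMap.id ℝ E →
      ∀ᶠ p in 𝓝 (0 : E × E), ∀ x, (T p).inverse (T p x) = x := by
    intro T hT h0
    have h1 := hT.eventually (show Set.range ((↑) : (E ≃L[ℝ] E) → E →L[ℝ] E) ∈ 𝓝 (T 0) by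
      rw [h0]; exact (ContinuousLinearEquiv.refl ℝ E).nhds)
    filter_upwards [h1] with p ⟨e, he⟩ x
    simp [← he]
  have hc := hm.contDiffAt_two.hasFDerivAt_fderiv.continuousAt
  have hP : ∀ᶠ p in 𝓝 (0 : E × E), ∀ x, (webP m p).inverse (webP m p x) = x := by
    refine hinv _ (ContinuousAt.congr (hc.clm_comp
      (continuousAt_const (y := ContinuousLinearMap.inl ℝ E E))) ?_) hm.webP_zero
    filter_upwards [hm.eventually_differentiableAt] with p hp using (webP_eq hp).symm
  have hQ : ∀ᶠ p in 𝓝 (0 : E × E), ∀ x, (webQ m p).inverse (webQ m p x) = x := by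
    refine hinv _ (ContinuousAt.congr (hc.clm_comp
      (continuousAt_const (y := ContinuousLinearMap.inr ℝ E E))) ?_) hm.webQ_zero
    filter_upwards [hm.eventually_differentiableAt] with p hp using (webQ_eq hp).symm
  constructor
  · filter_upwards [hP, hm.contDiffAt.eventually_contDiffAt (n := 3)] with p hp hd
    have hd : ContDiffAt ℝ 2 (fun q : E × E => m q.1 q.2) p := hd.of_le (by norm_num)
    simp [chernForm, chernGamma, hp, mixedDeriv_eq hd, ← Prod.zero_eq_mk]
  · filter_upwards [hQ, hm.contDiffAt.eventually_contDiffAt (n := 3)] with p hp hd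
    have hd : ContDiffAt ℝ 2 (fun q : E × E => m q.1 q.2) p := hd.of_le (by norm_num)
    simp [chernForm, chernGamma, hp, mixedDeriv_eq hd, ← Prod.zero_eq_mk]

lemma fderiv_chernForm_left (X ξ Y : E) :
    fderiv ℝ (fun q => chernForm m q (X, 0) ξ) 0 (0, Y) =
      -thirdFDeriv (fun q : E × E => m q.1 q.2) 0 (0, Y) (X, 0) (0, ξ) := by
  obtain ⟨Q1, hQ1, hQ1'⟩ := hm.hasFDerivAt_webQ_inverse ξ
  obtain ⟨S1, hS1, hS1'⟩ := hm.hasFDerivAt_mixedDeriv (hasFDerivAt_const X (0 : E × E)) hQ1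
  rw [(hS1.neg.congr_of_eventuallyEq (hm.eventually_chernForm X ξ).1).fderiv]
  simp [hS1', hQ1', hm.webQ_zero, loopM, ← Prod.zero_eq_mk]

lemma fderiv_chernForm_right (X ξ Y : E) :
    fderiv ℝ (fun q => chernForm m q (0, Y) ξ) 0 (X, 0) =
      -thirdFDeriv (fun q : E × E => m q.1 q.2) 0 (X, 0) (ξ, 0) (0, Y) := by
  obtain ⟨Q1, hQ1, hQ1'⟩ := hm.hasFDerivAt_webP_inverse ξ
  obtain ⟨S1, hS1, hS1'⟩ := hm.hasFDerivAt_mixedDeriv hQ1 (hasFDerivAt_const Y (0 : E × E))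
  rw [(hS1.neg.congr_of_eventuallyEq (hm.eventually_chernForm Y ξ).2).fderiv]
  simp [hS1', hQ1', hm.webP_zero, loopM, ← Prod.zero_eq_mk]

lemma chernCurvature_zero (ξ η ζ : E) : chernCurvature m 0 ξ η ζ =
    -thirdFDeriv (fun q : E × E => m q.1 q.2) 0 (η, 0) (ξ, 0) (0, ζ)
      + thirdFDeriv (fun q : E × E => m q.1 q.2) 0 (0, ζ) (η, 0) (0, ξ)
      + loopM m η (loopM m ξ ζ) - loopM m (loopM m η ξ) ζ := by
  simp only [chernCurvature, chernCurvatureForm, hm.webP_zero, hm.webQ_zero,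
    ContinuousLinearMap.inverse_id, ContinuousLinearMap.id_apply, hm.fderiv_chernForm_left,
    hm.fderiv_chernForm_right, hm.chernForm_zero, loopM_zero_left, loopM_zero_right,
    loopM_neg_left, loopM_neg_right, sub_zero, neg_zero, zero_sub, neg_neg, sub_neg_eq_add, zero_add]

/-- The covariant derivative of the torsion along the second foliation. -/
lemma nablaTwoTorsion_zero (ξ η ζ : E) : nablaTwoTorsion m 0 ξ η ζ = (1 / 2 : ℝ) •
    (thirdFDeriv (fun q : E × E => m q.1 q.2) 0 (0, ζ) (η, 0) (0, ξ)
      - thirdFDeriv (fun q : E × E => m q.1 q.2) 0 (0, ζ) (ξ, 0) (0, η)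
      + loopM m (loopM m ξ η) ζ - loopM m (loopM m η ξ) ζ
      + loopM m η (loopM m ξ ζ) - loopM m ξ (loopM m η ζ)) := by
  simp only [nablaTwoTorsion, covDerivTorsion, hm.webQ_zero,
    ContinuousLinearMap.inverse_id, ContinuousLinearMap.id_apply, hm.fderiv_chernTorsion,
    hm.chernForm_zero, loopM_zero_left, loopM_zero_right, hm.chernTorsion_zero,
    loopM_neg_left, loopM_neg_right, sub_eq_add_neg, loopM_add_left,
    loopM_smul_left, neg_zero, zero_add, add_zero]
  module

/-- The covariant derivative of the torsion along the first foliation. -/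
lemma nablaOneTorsion_zero (ξ η ζ : E) : nablaOneTorsion m 0 ξ η ζ = (1 / 2 : ℝ) •
    (thirdFDeriv (fun q : E × E => m q.1 q.2) 0 (ζ, 0) (η, 0) (0, ξ)
      - thirdFDeriv (fun q : E × E => m q.1 q.2) 0 (ζ, 0) (ξ, 0) (0, η)
      + loopM m ζ (loopM m ξ η) - loopM m ζ (loopM m η ξ)
      - loopM m (loopM m ζ ξ) η + loopM m (loopM m ζ η) ξ) := by
  simp only [nablaOneTorsion, covDerivTorsion, hm.webP_zero,
    ContinuousLinearMap.inverse_id, ContinuousLinearMap.id_apply, hm.fderiv_chernTorsion,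
    hm.chernForm_zero, loopM_zero_left, loopM_zero_right, hm.chernTorsion_zero,
    loopM_neg_left, loopM_neg_right, sub_eq_add_neg, loopM_add_right,
    loopM_smul_right, neg_zero, add_zero]
  module

/-- Antisymmetrising the curvature in its first two arguments cancels the xxy derivatives, which are
symmetric in the two x-directions; the xyy ones are those of the torsion. -/
lemma nablaTwoTorsion_zero_eq_chernCurvature (ξ η ζ : E) : nablaTwoTorsion m 0 ξ η ζ
    = (1 / 2 : ℝ) • (chernCurvature m 0 ξ η ζ - chernCurvature m 0 η ξ ζ) := by
  rw [hm.nablaTwoTorsion_zero, hm.chernCurvature_zero, hm.chernCurvature_zero,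
    hm.contDiffAt.thirdFDeriv_symm_left (η, 0) (ξ, 0)]
  module

/-- Here the antisymmetrisation is in the first and third arguments, so the xyy derivatives cancel
and the xxy ones remain. -/
lemma nablaOneTorsion_zero_eq_chernCurvature (ξ η ζ : E) : nablaOneTorsion m 0 ξ η ζ
    = (1 / 2 : ℝ) • (chernCurvature m 0 ξ ζ η - chernCurvature m 0 η ζ ξ) := by
  rw [hm.nablaOneTorsion_zero, hm.chernCurvature_zero, hm.chernCurvature_zero,
    hm.contDiffAt.thirdFDeriv_symm_left (0, η) (ζ, 0) (0, ξ),
    hm.contDiffAt.thirdFDeriv_symm_right (ζ, 0) (0, η) (0, ξ),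
    hm.contDiffAt.thirdFDeriv_symm_left (ζ, 0) (0, ξ) (0, η)]
  module

end IsLocalLoop

end NeutralWeb

/-! ### Third-order consequence of an action law. -/

section LocalAction

variable {E W : Type*} [NormedAddCommGroup E] [NormedSpace ℝ E] [NormedAddCommGroup W]
  [NormedSpace ℝ W]

/-- The third order consequence of the law `(a b) y = a (b y)` of a local action. -/
lemma IsLocalLoop.thirdFDeriv_action {m : E → E → E} (hm : IsLocalLoop m) {A : E → W → W}
    (hA : ContDiffAt ℝ 3 (fun q : E × W => A q.1 q.2) 0)
    (hA0 : ∀ᶠ y in 𝓝 (0 : W), A 0 y = y)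
    (hassoc : ∀ᶠ p in 𝓝 (0 : E × E × W), A (m p.1 p.2.1) p.2.2 = A p.1 (A p.2.1 p.2.2))
    (a b : E) (y : W) :
    secondFDeriv (fun q : E × W => A q.1 q.2) 0 (loopM m a b, 0) (0, y)
      + thirdFDeriv (fun q : E × W => A q.1 q.2) 0 (a, 0) (b, 0) (0, y)
    = secondFDeriv (fun q : E × W => A q.1 q.2) 0 (a, 0)
        (0, secondFDeriv (fun q : E × W => A q.1 q.2) 0 (b, 0) (0, y))
      + thirdFDeriv (fun q : E × W => A q.1 q.2) 0 (a, 0)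
        (0, fderiv ℝ (fun q : E × W => A q.1 q.2) 0 (b, 0)) (0, y) := by
  have hm00 : m 0 0 = 0 := hm.left_neutral.self_of_nhds
  have hA00 : A 0 0 = 0 := hA0.self_of_nhds
  have hAy : ∀ y, fderiv ℝ (fun q : E × W => A q.1 q.2) 0 (0, y) = y := by
    intro y
    rw [← fderiv_partial_right (f := A) (p := (0 : E × W)) (hA.differentiableAt (by norm_num)) y]
    change fderiv ℝ (fun y => A 0 y) 0 y = y
    rw [EventuallyEq.fderiv_eq (f := fun y => y) hA0]
    simp
  -- The arguments of both sides of the law are written through linear projections of the triple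
  -- `(a, b, y)`, whose higher derivatives vanish in the chain rule.
  let L₁ : E × E × W →L[ℝ] E × E :=
    (ContinuousLinearMap.fst ℝ E (E × W)).prod
      ((ContinuousLinearMap.fst ℝ E W).comp (ContinuousLinearMap.snd ℝ E (E × W)))
  let L₂ : E × E × W →L[ℝ] W :=
    (ContinuousLinearMap.snd ℝ E W).comp (ContinuousLinearMap.snd ℝ E (E × W))
  let L₃ : E × E × W →L[ℝ] E := ContinuousLinearMap.fst ℝ E (E × W)
  let L₄ : E × E × W →L[ℝ] E × W := ContinuousLinearMap.snd ℝ E (E × W)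
  have hmL : ContDiffAt ℝ 3 (fun p => (fun q : E × E => m q.1 q.2) (L₁ p)) 0 :=
    ContDiffAt.comp_at_eq hm.contDiffAt L₁.contDiff.contDiffAt (map_zero L₁)
  have hAL : ContDiffAt ℝ 3 (fun p => (fun q : E × W => A q.1 q.2) (L₄ p)) 0 :=
    ContDiffAt.comp_at_eq hA L₄.contDiff.contDiffAt (map_zero L₄)
  have hL2 : ContDiffAt ℝ 3 L₂ 0 := L₂.contDiff.contDiffAt
  have hL3 : ContDiffAt ℝ 3 L₃ 0 := L₃.contDiff.contDiffAt
  have key : (fun p => (fun q : E × W => A q.1 q.2)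
        ((fun p => ((fun q : E × E => m q.1 q.2) (L₁ p), L₂ p)) p))
      =ᶠ[𝓝 0] (fun p => (fun q : E × W => A q.1 q.2)
        ((fun p => (L₃ p, (fun q : E × W => A q.1 q.2) (L₄ p))) p)) := hassoc
  have h12 : (1 : WithTop ℕ∞) ≤ 3 := by norm_num
  have h23 : (2 : WithTop ℕ∞) ≤ 3 := by norm_num
  have hmf : ∀ u, fderiv ℝ (fun p => (fun q : E × E => m q.1 q.2) (L₁ p)) 0 u
      = (L₁ u).1 + (L₁ u).2 := by
    intro u
    rw [fderiv_comp_apply (g := fun q : E × E => m q.1 q.2) (f := L₁)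
      (by rw [map_zero]; exact hm.contDiffAt.of_le h12) (L₁.contDiff.contDiffAt), map_zero,
      hm.fderiv_zero, L₁.fderiv]
  have hAf : ∀ u, fderiv ℝ (fun p => (fun q : E × W => A q.1 q.2) (L₄ p)) 0 u
      = fderiv ℝ (fun q : E × W => A q.1 q.2) 0 (L₄ u) := by
    intro u
    rw [fderiv_comp_apply (g := fun q : E × W => A q.1 q.2) (f := L₄)
      (by rw [map_zero]; exact hA.of_le h12) (L₄.contDiff.contDiffAt), map_zero, L₄.fderiv]
  -- One direction from each of the three factors: this extracts the coefficient of the law that is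
  -- trilinear in `a`, `b`, `y`.
  have h3 := congrArg (fun T => T (a, (0 : E), (0 : W)) ((0 : E), b, (0 : W)) ((0 : E), (0 : E), y))
    key.thirdFDeriv_eq
  dsimp only at h3
  rw [thirdFDeriv_comp_apply (g := fun q : E × W => A q.1 q.2) (by
      have : ((fun q : E × E => m q.1 q.2) (L₁ 0), L₂ 0) = 0 := by simp [L₁, L₂, hm00]
      rw [this]; exact hA) (hmL.prodMk hL2),
    thirdFDeriv_comp_apply (g := fun q : E × W => A q.1 q.2) (by
      have : (L₃ 0, (fun q : E × W => A q.1 q.2) (L₄ 0)) = 0 := by simp [L₃, L₄, hA00]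
      rw [this]; exact hA) (hL3.prodMk hAL)] at h3
  simp only [fderiv_prodMk_apply (hmL.of_le h12) (hL2.of_le h12),
    fderiv_prodMk_apply (hL3.of_le h12) (hAL.of_le h12),
    secondFDeriv_prodMk_apply (hmL.of_le h23) (hL2.of_le h23),
    secondFDeriv_prodMk_apply (hL3.of_le h23) (hAL.of_le h23),
    thirdFDeriv_prodMk_apply hmL hL2, thirdFDeriv_prodMk_apply hL3 hAL, hmf, hAf,
    secondFDeriv_comp_clm (f := fun q : E × E => m q.1 q.2) L₁ (y := 0) hm.contDiffAt_two
      (map_zero L₁),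
    secondFDeriv_comp_clm (f := fun q : E × W => A q.1 q.2) L₄ (y := 0) (hA.of_le h23)
      (map_zero L₄),
    thirdFDeriv_comp_clm (f := fun q : E × E => m q.1 q.2) L₁ (y := 0) hm.contDiffAt (map_zero L₁),
    thirdFDeriv_comp_clm (f := fun q : E × W => A q.1 q.2) L₄ (y := 0) hA (map_zero L₄),
    L₂.secondFDeriv_eq_zero, L₃.secondFDeriv_eq_zero, L₂.thirdFDeriv_eq_zero,
    L₃.thirdFDeriv_eq_zero, L₂.fderiv, L₃.fderiv] at h3
  simp [L₁, L₂, L₃, L₄, hm00, hA00, ← Prod.zero_eq_mk, hAy] at h3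
  rw [add_comm, loopM, h3, add_comm]

end LocalAction

/-! ### The Lie bracket as a Taylor coefficient, and normal coordinates. -/

namespace LocalLieGroup

variable {𝔤 : Type*} [NormedAddCommGroup 𝔤] [NormedSpace ℝ 𝔤] (G : LocalLieGroup 𝔤)

lemma isLocalLoop : IsLocalLoop G.mul where
  contDiffAt := G.smooth_mul.self_of_nhds.of_le (WithTop.coe_le_coe.2 le_top)
  right_neutral := G.mul_one
  left_neutral := G.one_mul

lemma mul_zero_zero : G.mul 0 0 = 0 := G.mul_one.self_of_nhds

lemma contDiffAt_inv : ContDiffAt ℝ 3 G.inv 0 :=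
  G.smooth_inv.self_of_nhds.of_le (WithTop.coe_le_coe.2 le_top)

/-- Differentiate `x · x⁻¹ = 0`, using that the derivative of the product is the sum. -/
lemma fderiv_inv (x : 𝔤) : fderiv ℝ G.inv 0 x = -x := by
  have h1 : (1 : WithTop ℕ∞) ≤ 3 := by norm_num
  have hid : ContDiffAt ℝ 1 (fun x : 𝔤 => x) 0 := contDiffAt_id
  have hi := G.contDiffAt_inv.of_le h1
  have h := fderiv_comp_apply (g := fun q : 𝔤 × 𝔤 => G.mul q.1 q.2) (f := fun x => (x, G.inv x))
    (x := 0) (by rw [G.inv_zero]; exact G.isLocalLoop.contDiffAt.of_le h1) (hid.prodMk hi) x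
  rw [fderiv_prodMk_apply hid hi, G.inv_zero, ← Prod.zero_eq_mk, G.isLocalLoop.fderiv_zero,
    EventuallyEq.fderiv_eq (f := fun _ => (0 : 𝔤)) G.mul_inv] at h
  simp only [fderiv_fun_const, Pi.zero_apply, _root_.zero_apply, fderiv_fun_id,
    ContinuousLinearMap.id_apply] at h
  exact eq_neg_of_add_eq_zero_right h.symm

/-- The left-invariant field of `x` has derivative `v ↦ loopM G.mul v x` at the identity. -/
lemma bracket_eq (x y : 𝔤) : G.bracket x y = loopM G.mul x y - loopM G.mul y x := by
  have hfield : ∀ x, G.leftInvariantField x =ᶠ[𝓝 0]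
      fun g => fderiv ℝ (fun q : 𝔤 × 𝔤 => G.mul q.1 q.2) (g, 0) (0, x) := by
    intro x
    have hc : ContinuousAt (fun g : 𝔤 => (g, (0 : 𝔤))) 0 := by fun_prop
    filter_upwards [hc.eventually G.isLocalLoop.eventually_differentiableAt] with g hg
    exact fderiv_partial_right (f := G.mul) (p := (g, 0)) hg x
  have hder : ∀ x v, fderiv ℝ (G.leftInvariantField x) 0 v = loopM G.mul v x := by
    intro x v
    have h1 := (G.isLocalLoop.contDiffAt_two.hasFDerivAt_fderiv.comp
      (f := fun g : 𝔤 => (g, (0 : 𝔤))) 0 (hasFDerivAt_prodMk_left 0 0)).clm_apply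
      (hasFDerivAt_const ((0, x) : 𝔤 × 𝔤) (0 : 𝔤))
    rw [(h1.congr_of_eventuallyEq (hfield x)).fderiv]
    simp [loopM]
  have hval : ∀ x, G.leftInvariantField x 0 = x := by
    intro x
    rw [(hfield x).self_of_nhds]
    exact G.isLocalLoop.fderiv_right x
  rw [bracket, VectorField.lieBracket, hder, hder, hval, hval]

lemma bracket_swap (x y : 𝔤) : G.bracket x y = -G.bracket y x := by
  rw [bracket_eq, bracket_eq]; abel

lemma bracket_add_left (x y z : 𝔤) : G.bracket (x + y) z = G.bracket x z + G.bracket y z := by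
  simp only [bracket_eq, IsLocalLoop.loopM_add_left, IsLocalLoop.loopM_add_right]; abel

lemma bracket_add_right (x y z : 𝔤) : G.bracket x (y + z) = G.bracket x y + G.bracket x z := by
  simp only [bracket_eq, IsLocalLoop.loopM_add_left, IsLocalLoop.loopM_add_right]; abel

lemma bracket_smul_left (c : ℝ) (x y : 𝔤) : G.bracket (c • x) y = c • G.bracket x y := by
  simp only [bracket_eq, IsLocalLoop.loopM_smul_left, IsLocalLoop.loopM_smul_right, smul_sub]

lemma bracket_smul_right (c : ℝ) (x y : 𝔤) : G.bracket x (c • y) = c • G.bracket x y := by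
  simp only [bracket_eq, IsLocalLoop.loopM_smul_left, IsLocalLoop.loopM_smul_right, smul_sub]

lemma bracket_neg_left (x y : 𝔤) : G.bracket (-x) y = -G.bracket x y := by
  simpa using G.bracket_smul_left (-1) x y

lemma bracket_neg_right (x y : 𝔤) : G.bracket x (-y) = -G.bracket x y := by
  simpa using G.bracket_smul_right (-1) x y

lemma bracket_sub_left (x y z : 𝔤) : G.bracket (x - y) z = G.bracket x z - G.bracket y z := by
  rw [sub_eq_add_neg, bracket_add_left, bracket_neg_left, ← sub_eq_add_neg]

lemma bracket_sub_right (x y z : 𝔤) : G.bracket x (y - z) = G.bracket x y - G.bracket x z := by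
  rw [sub_eq_add_neg, bracket_add_right, bracket_neg_right, ← sub_eq_add_neg]

/-- On a pair of multiples of one vector the product is `(s, t) ↦ (s + t) x`, which is linear. -/
lemma IsNormal.loopM_self {G : LocalLieGroup 𝔤} (hG : G.IsNormal) (x : 𝔤) :
    loopM G.mul x x = 0 := by
  have hsmall : ∀ᶠ x in 𝓝 (0 : 𝔤), loopM G.mul x x = 0 := by
    filter_upwards [hG] with x hx
    let L : ℝ × ℝ →L[ℝ] 𝔤 × 𝔤 :=
      ((ContinuousLinearMap.fst ℝ ℝ ℝ).smulRight x).prod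
        ((ContinuousLinearMap.snd ℝ ℝ ℝ).smulRight x)
    let L' : ℝ × ℝ →L[ℝ] 𝔤 :=
      (ContinuousLinearMap.fst ℝ ℝ ℝ + ContinuousLinearMap.snd ℝ ℝ ℝ).smulRight x
    have he : (fun p => (fun q : 𝔤 × 𝔤 => G.mul q.1 q.2) (L p)) =ᶠ[𝓝 0] L' := by
      have hI : Set.Icc (-1 : ℝ) 1 ∈ 𝓝 (0 : ℝ) := Icc_mem_nhds (by norm_num) (by norm_num)
      filter_upwards [prod_mem_nhds hI hI] with p hp
      exact hx _ hp.1 _ hp.2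
    have h := secondFDeriv_comp_clm (f := fun q : 𝔤 × 𝔤 => G.mul q.1 q.2) L
      G.isLocalLoop.contDiffAt_two (map_zero L) (1, 0) (0, 1)
    rw [he.secondFDeriv_eq, L'.secondFDeriv_eq_zero] at h
    simpa [L, loopM] using h.symm
  -- Normality speaks only of small vectors; an arbitrary `x` is rescaled by some `t ≠ 0`, and the
  -- factor `t²` is cancelled.
  have ht : Tendsto (fun t : ℝ => t • x) (𝓝[≠] 0) (𝓝 0) := by
    have : Tendsto (fun t : ℝ => t • x) (𝓝 0) (𝓝 ((0 : ℝ) • x)) :=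
      (continuous_id.smul continuous_const).tendsto 0
    rw [zero_smul] at this
    exact this.mono_left nhdsWithin_le_nhds
  obtain ⟨t, ht0, ht⟩ := ((ht.eventually hsmall).and self_mem_nhdsWithin).exists
  rw [IsLocalLoop.loopM_smul_left, IsLocalLoop.loopM_smul_right] at ht0
  simpa [show t ≠ 0 from ht] using ht0

/-- Polarisation of `loopM_self`: in normal coordinates the mixed coefficient is already
antisymmetric. -/
lemma IsNormal.loopM_eq {G : LocalLieGroup 𝔤} (hG : G.IsNormal) (x y : 𝔤) :
    loopM G.mul x y = (1 / 2 : ℝ) • G.bracket x y := by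
  have h := hG.loopM_self (x + y)
  rw [IsLocalLoop.loopM_add_left, IsLocalLoop.loopM_add_right, IsLocalLoop.loopM_add_right,
    hG.loopM_self, hG.loopM_self, zero_add, add_zero] at h
  rw [bracket_eq, eq_neg_of_add_eq_zero_right h]
  module

/-- Associativity is the action law of `G` on itself, so its third-order part relates double
brackets to third derivatives of the product. -/
lemma IsNormal.jacobi {G : LocalLieGroup 𝔤} (hG : G.IsNormal) (x y z : 𝔤) :
    G.bracket (G.bracket x y) z
      = G.bracket (G.bracket x z) y - G.bracket (G.bracket y z) x := by
  have key := fun a b c => G.isLocalLoop.thirdFDeriv_action G.isLocalLoop.contDiffAt G.one_mul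
    G.mul_assoc a b c
  simp only [G.isLocalLoop.fderiv_left] at key
  change ∀ a b c, loopM G.mul (loopM G.mul a b) c + _ = loopM G.mul a (loopM G.mul b c) + _ at key
  simp only [hG.loopM_eq, bracket_smul_left, bracket_smul_right] at key
  have s1 := fun u v w => G.isLocalLoop.contDiffAt.thirdFDeriv_symm_left (u, 0) (v, 0) (0, w)
  have s2 := fun u v w => G.isLocalLoop.contDiffAt.thirdFDeriv_symm_right (u, 0) (0, v) (0, w)
  have k1 := key x y z
  have k2 := key y z x
  have k3 := key z x y
  have k4 := key y x z
  have k5 := key x z y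
  have k6 := key z y x
  rw [s1 y x, s2 y x z] at k4
  rw [s1 x z, s2 x z y] at k5
  rw [s1 z y, s2 z y x] at k6
  rw [G.bracket_swap x (G.bracket y z)] at k1
  rw [G.bracket_swap y (G.bracket z x), G.bracket_swap z x, G.bracket_neg_left] at k2
  rw [G.bracket_swap z (G.bracket x y), G.bracket_swap z x, G.bracket_neg_left] at k3
  rw [G.bracket_swap y (G.bracket x z), G.bracket_swap y x, G.bracket_neg_left] at k4
  rw [G.bracket_swap x (G.bracket z y), G.bracket_swap z y, G.bracket_neg_left] at k5
  rw [G.bracket_swap z (G.bracket y x), G.bracket_swap z y, G.bracket_swap y x,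
    G.bracket_neg_left, G.bracket_neg_left] at k6
  -- In the alternating sum over the six permutations every third derivative cancels, each type
  -- being symmetric in two of its slots.
  linear_combination (norm := module) k1 + k2 + k3 - k4 - k5 - k6

end LocalLieGroup

/-! ### Coset loops of a section and a transversal submanifold. -/

namespace LocalLieGroup

variable {𝔤 : Type*} [NormedAddCommGroup 𝔤] [NormedSpace ℝ 𝔤] (G : LocalLieGroup 𝔤)
  {V 𝔥 : Submodule ℝ 𝔤}

/-- A parametrised section `s` and a parametrised complementary submanifold `k` through the
identity whose tangent spaces are complementary, as witnessed by `e`. -/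
structure IsTransversal (s : V → 𝔤) (k : 𝔥 → 𝔤) (e : (V × 𝔥) ≃L[ℝ] 𝔤) : Prop where
  contDiffAt_left : ContDiffAt ℝ 3 s 0
  contDiffAt_right : ContDiffAt ℝ 3 k 0
  left_zero : s 0 = 0
  right_zero : k 0 = 0
  equiv_apply : ∀ p, e p = fderiv ℝ s 0 p.1 + fderiv ℝ k 0 p.2

/-- The action of the group on the section that is induced by the action on cosets. -/
noncomputable def cosetAction (s : V → 𝔤) (k : 𝔥 → 𝔤) (a : 𝔤) (y : V) : V :=
  G.cosetProj s k (G.mul a (s y))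

lemma contDiffAt_mul_comp {X : Type*} [NormedAddCommGroup X] [NormedSpace ℝ X] {f g : X → 𝔤}
    {x : X} (hf : ContDiffAt ℝ 3 f x) (hg : ContDiffAt ℝ 3 g x) (hf0 : f x = 0) (hg0 : g x = 0) :
    ContDiffAt ℝ 3 (fun z => G.mul (f z) (g z)) x :=
  G.isLocalLoop.contDiffAt.comp_at_eq (hf.prodMk hg) (by simp [hf0, hg0])

lemma fderiv_mul_comp {X : Type*} [NormedAddCommGroup X] [NormedSpace ℝ X] {f g : X → 𝔤}
    {x : X} (hf : ContDiffAt ℝ 3 f x) (hg : ContDiffAt ℝ 3 g x) (hf0 : f x = 0) (hg0 : g x = 0)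
    (v : X) : fderiv ℝ (fun z => G.mul (f z) (g z)) x v = fderiv ℝ f x v + fderiv ℝ g x v := by
  have h1 : (1 : WithTop ℕ∞) ≤ 3 := by norm_num
  have h := fderiv_comp_apply (g := fun q : 𝔤 × 𝔤 => G.mul q.1 q.2) (f := fun z => (f z, g z))
    (x := x) (by rw [hf0, hg0]; exact G.isLocalLoop.contDiffAt.of_le h1)
    ((hf.prodMk hg).of_le h1) v
  rw [h, fderiv_prodMk_apply (hf.of_le h1) (hg.of_le h1), hf0, hg0, ← Prod.zero_eq_mk,
    G.isLocalLoop.fderiv_zero]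

lemma secondFDeriv_mul_comp {X : Type*} [NormedAddCommGroup X] [NormedSpace ℝ X] {f g : X → 𝔤}
    {x : X} (hf : ContDiffAt ℝ 3 f x) (hg : ContDiffAt ℝ 3 g x) (hf0 : f x = 0) (hg0 : g x = 0)
    (v w : X) : secondFDeriv (fun z => G.mul (f z) (g z)) x v w
      = loopM G.mul (fderiv ℝ f x v) (fderiv ℝ g x w)
        + loopM G.mul (fderiv ℝ f x w) (fderiv ℝ g x v)
        + secondFDeriv f x v w + secondFDeriv g x v w := by
  have h1 : (1 : WithTop ℕ∞) ≤ 3 := by norm_num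
  have h2 : (2 : WithTop ℕ∞) ≤ 3 := by norm_num
  have h := secondFDeriv_comp_apply (g := fun q : 𝔤 × 𝔤 => G.mul q.1 q.2)
    (f := fun z => (f z, g z)) (x := x)
    (by rw [hf0, hg0]; exact G.isLocalLoop.contDiffAt_two) ((hf.prodMk hg).of_le h2) v w
  rw [h]
  simp only [fderiv_prodMk_apply (hf.of_le h1) (hg.of_le h1),
    secondFDeriv_prodMk_apply (hf.of_le h2) (hg.of_le h2), hf0, hg0, ← Prod.zero_eq_mk,
    G.isLocalLoop.fderiv_zero]
  have hsplit : ∀ a b c d : 𝔤, secondFDeriv (fun q : 𝔤 × 𝔤 => G.mul q.1 q.2) 0 (a, b) (c, d)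
      = loopM G.mul a d + loopM G.mul c b := by
    intro a b c d
    rw [show ((a, b) : 𝔤 × 𝔤) = (a, 0) + (0, b) by simp,
      show ((c, d) : 𝔤 × 𝔤) = (c, 0) + (0, d) by simp]
    simp only [map_add, _root_.add_apply, G.isLocalLoop.secondFDeriv_left,
      G.isLocalLoop.secondFDeriv_right,
      G.isLocalLoop.contDiffAt_two.secondFDeriv_symm (0, b) (c, 0), loopM, zero_add, add_zero]
    exact add_comm _ _
  rw [hsplit]
  abel

namespace IsTransversal

variable {G} {s : V → 𝔤} {k : 𝔥 → 𝔤} {e : (V × 𝔥) ≃L[ℝ] 𝔤} (hT : IsTransversal s k e)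

include hT

lemma contDiffAt_param :
    ContDiffAt ℝ 3 (fun p : V × 𝔥 => G.mul (s p.1) (k p.2)) 0 :=
  G.contDiffAt_mul_comp (hT.contDiffAt_left.comp_at_eq contDiffAt_fst rfl)
    (hT.contDiffAt_right.comp_at_eq contDiffAt_snd rfl) hT.left_zero hT.right_zero

lemma hasFDerivAt_param :
    HasFDerivAt (fun p : V × 𝔥 => G.mul (s p.1) (k p.2)) (e : (V × 𝔥) →L[ℝ] 𝔤) 0 := by
  have h := (hT.contDiffAt_param (G := G)).differentiableAt (by norm_num)
  have hp : ∀ p, (e : (V × 𝔥) →L[ℝ] 𝔤) p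
      = fderiv ℝ (fun p : V × 𝔥 => G.mul (s p.1) (k p.2)) 0 p := fun p => ?_
  · rw [ContinuousLinearMap.ext hp]; exact h.hasFDerivAt
  have h1 : (1 : WithTop ℕ∞) ≤ 3 := by norm_num
  rw [G.fderiv_mul_comp (hT.contDiffAt_left.comp_at_eq contDiffAt_fst rfl)
    (hT.contDiffAt_right.comp_at_eq contDiffAt_snd rfl) hT.left_zero hT.right_zero,
    fderiv_comp_apply (f := Prod.fst) (hT.contDiffAt_left.of_le h1) contDiffAt_fst,
    fderiv_comp_apply (f := Prod.snd) (hT.contDiffAt_right.of_le h1) contDiffAt_snd]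
  rw [fderiv_fst, fderiv_snd]
  simpa using hT.equiv_apply p

variable (G) in
/-- Factorisation of the group elements near the identity. -/
lemma exists_factorization [FiniteDimensional ℝ 𝔤] : ∃ χ : 𝔤 → 𝔥,
    ContDiffAt ℝ 3 (G.cosetProj s k) 0 ∧ ContDiffAt ℝ 3 χ 0 ∧
    (∀ᶠ g in 𝓝 (0 : 𝔤), G.mul (s (G.cosetProj s k g)) (k (χ g)) = g) ∧
    ∀ᶠ p in 𝓝 (0 : V × 𝔥), G.cosetProj s k (G.mul (s p.1) (k p.2)) = p.1 ∧
      χ (G.mul (s p.1) (k p.2)) = p.2 := by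
  have : CompleteSpace (V × 𝔥) := FiniteDimensional.complete ℝ _
  set Φ : V × 𝔥 → 𝔤 := fun p => G.mul (s p.1) (k p.2) with hΦ
  have hΦ0 : Φ 0 = 0 := by simp [hΦ, hT.left_zero, hT.right_zero, G.mul_zero_zero]
  have hc : ContDiffAt ℝ 3 Φ 0 := hT.contDiffAt_param
  have hd : HasFDerivAt Φ (e : (V × 𝔥) →L[ℝ] 𝔤) 0 := hT.hasFDerivAt_param
  have hst := hc.hasStrictFDerivAt' hd (by norm_num)
  let Ψ := hc.localInverse hd (by norm_num)
  have hΨ : ContDiffAt ℝ 3 Ψ 0 := hΦ0 ▸ hc.to_localInverse hd (by norm_num)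
  have hleft : ∀ᶠ p in 𝓝 (0 : V × 𝔥), Ψ (Φ p) = p := hst.eventually_left_inverse
  have hright : ∀ᶠ g in 𝓝 (0 : 𝔤), Φ (Ψ g) = g := hΦ0 ▸ hst.eventually_right_inverse
  have hΨ0 : Ψ 0 = 0 := by
    have := hleft.self_of_nhds
    rwa [hΦ0] at this
  -- The projection is only a chosen function; the first component of the local inverse witnesses
  -- that the choice is not vacuous.
  have hspec : ∀ᶠ p in 𝓝 (0 : V × 𝔥), G.cosetProj s k (Φ p) = p.1 := by
    refine Classical.epsilon_spec (p := fun π : 𝔤 → V => ∀ᶠ p in 𝓝 (0 : V × 𝔥),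
      π (G.mul (s p.1) (k p.2)) = p.1) ⟨fun g => (Ψ g).1, ?_⟩
    filter_upwards [hleft] with p hp
    exact congrArg Prod.fst hp
  have hΨt : Tendsto Ψ (𝓝 0) (𝓝 0) := by simpa [ContinuousAt, hΨ0] using hΨ.continuousAt
  -- Every element near the identity has the form `Φ p` with `p` small, so the defining property
  -- fixes the germ of the chosen function, which inherits the smoothness of `Ψ`.
  have heq : G.cosetProj s k =ᶠ[𝓝 0] fun g => (Ψ g).1 := by
    filter_upwards [hright, hΨt.eventually hspec] with g hg hg'
    rwa [hg] at hg'
  refine ⟨fun g => (Ψ g).2, (contDiffAt_fst.comp 0 hΨ).congr_of_eventuallyEq heq,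
    contDiffAt_snd.comp 0 hΨ, ?_, ?_⟩
  · filter_upwards [heq, hright] with g hg hg'
    rw [hg]
    exact hg'
  · filter_upwards [hspec, hleft] with p hp hp'
    exact ⟨hp, congrArg Prod.snd hp'⟩

variable [FiniteDimensional ℝ 𝔤]

lemma contDiffAt_cosetProj : ContDiffAt ℝ 3 (G.cosetProj s k) 0 :=
  (hT.exists_factorization G).choose_spec.1

lemma cosetProj_section : ∀ᶠ x in 𝓝 (0 : V), G.cosetProj s k (s x) = x := by
  obtain ⟨χ, -, -, -, h⟩ := hT.exists_factorization G
  have hc : Tendsto (fun x : V => (x, (0 : 𝔥))) (𝓝 0) (𝓝 0) := by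
    have : ContinuousAt (fun x : V => (x, (0 : 𝔥))) 0 := by fun_prop
    exact this
  have hs : Tendsto s (𝓝 0) (𝓝 0) := by
    simpa [ContinuousAt, hT.left_zero] using hT.contDiffAt_left.continuousAt
  filter_upwards [hc.eventually h, hs.eventually G.mul_one] with x hx hx'
  rw [hT.right_zero, hx'] at hx
  exact hx.1

lemma cosetProj_zero : G.cosetProj s k 0 = 0 := by
  simpa [hT.left_zero] using (hT.cosetProj_section (G := G)).self_of_nhds

/-- Differentiate `π (s x · k h) = x`: the parametrisation has derivative `e`. -/
lemma fderiv_cosetProj (w : 𝔤) : fderiv ℝ (G.cosetProj s k) 0 w = (e.symm w).1 := by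
  obtain ⟨χ, hπ, hχ, h1, h2⟩ := hT.exists_factorization G
  obtain ⟨p, rfl⟩ := e.surjective w
  have hΦ0 : G.mul (s (0 : V × 𝔥).1) (k (0 : V × 𝔥).2) = 0 := by
    simp [hT.left_zero, hT.right_zero, G.mul_zero_zero]
  have h := (hΦ0.symm ▸ (hπ.differentiableAt (by norm_num)).hasFDerivAt : HasFDerivAt
    (G.cosetProj s k) (fderiv ℝ (G.cosetProj s k) 0) (G.mul (s (0 : V × 𝔥).1) (k (0 : V × 𝔥).2)))
    |>.comp (0 : V × 𝔥) (hT.hasFDerivAt_param (G := G))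
  have h' : HasFDerivAt (fun p : V × 𝔥 => p.1) (ContinuousLinearMap.fst ℝ V 𝔥) 0 :=
    hasFDerivAt_fst
  have := (h.congr_of_eventuallyEq (f₁ := fun p : V × 𝔥 => p.1)
    (by filter_upwards [h2] with p hp using hp.1.symm)).unique h'
  have := congrArg (fun T : (V × 𝔥) →L[ℝ] V => T p) this
  simpa using this

lemma contDiffAt_cosetAction :
    ContDiffAt ℝ 3 (fun q : 𝔤 × V => G.cosetAction s k q.1 q.2) 0 :=
  (hT.contDiffAt_cosetProj (G := G)).comp_at_eq (G.contDiffAt_mul_comp contDiffAt_fst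
    (hT.contDiffAt_left.comp_at_eq contDiffAt_snd rfl) rfl hT.left_zero)
    (by simp [hT.left_zero, G.mul_zero_zero])

lemma cosetAction_zero_left : ∀ᶠ y in 𝓝 (0 : V), G.cosetAction s k 0 y = y := by
  have hs : Tendsto s (𝓝 0) (𝓝 0) := by
    simpa [ContinuousAt, hT.left_zero] using hT.contDiffAt_left.continuousAt
  filter_upwards [hT.cosetProj_section (G := G), hs.eventually G.one_mul] with y hy hy'
  rw [cosetAction, hy', hy]

lemma isLocalLoop : IsLocalLoop (G.cosetLoop s k) where
  contDiffAt := (hT.contDiffAt_cosetProj (G := G)).comp_at_eq (G.contDiffAt_mul_comp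
    (hT.contDiffAt_left.comp_at_eq contDiffAt_fst rfl)
    (hT.contDiffAt_left.comp_at_eq contDiffAt_snd rfl) hT.left_zero hT.left_zero)
    (by simp [hT.left_zero, G.mul_zero_zero])
  left_neutral := by
    filter_upwards [hT.cosetAction_zero_left (G := G)] with y hy
    rw [cosetLoop, hT.left_zero]; exact hy
  right_neutral := by
    have hs : Tendsto s (𝓝 0) (𝓝 0) := by
      simpa [ContinuousAt, hT.left_zero] using hT.contDiffAt_left.continuousAt
    filter_upwards [hT.cosetProj_section (G := G), hs.eventually G.mul_one] with y hy hy'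
    rw [cosetLoop, hT.left_zero, hy', hy]

omit [FiniteDimensional ℝ 𝔤] in
lemma symm_left (y : V) : e.symm (fderiv ℝ s 0 y) = (y, 0) := by
  rw [ContinuousLinearEquiv.symm_apply_eq, hT.equiv_apply]; simp

omit [FiniteDimensional ℝ 𝔤] in
lemma symm_right (y : 𝔥) : e.symm (fderiv ℝ k 0 y) = (0, y) := by
  rw [ContinuousLinearEquiv.symm_apply_eq, hT.equiv_apply]; simp

lemma fderiv_cosetAction (p : 𝔤 × V) :
    fderiv ℝ (fun q : 𝔤 × V => G.cosetAction s k q.1 q.2) 0 p = (e.symm p.1).1 + p.2 := by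
  have h1 : (1 : WithTop ℕ∞) ≤ 3 := by norm_num
  have hs : ContDiffAt ℝ 3 (fun q : 𝔤 × V => s q.2) 0 :=
    hT.contDiffAt_left.comp_at_eq contDiffAt_snd rfl
  have hr := G.contDiffAt_mul_comp (x := (0 : 𝔤 × V)) contDiffAt_fst hs rfl hT.left_zero
  have hr0 : G.mul (0 : 𝔤 × V).1 (s (0 : 𝔤 × V).2) = 0 := by
    simp [hT.left_zero, G.mul_zero_zero]
  have h := fderiv_comp_apply (g := G.cosetProj s k) (x := (0 : 𝔤 × V))
    (f := fun q : 𝔤 × V => G.mul q.1 (s q.2))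
    (by rw [hr0]; exact (hT.contDiffAt_cosetProj (G := G)).of_le h1) (hr.of_le h1) p
  have h' := fderiv_comp_apply (f := fun q : 𝔤 × V => q.2) (x := 0)
    (hT.contDiffAt_left.of_le h1) contDiffAt_snd p
  change fderiv ℝ (fun q : 𝔤 × V => G.cosetProj s k (G.mul q.1 (s q.2))) 0 p = _
  rw [h, hr0, hT.fderiv_cosetProj, G.fderiv_mul_comp contDiffAt_fst hs rfl hT.left_zero, map_add,
    h']
  have e1 : fderiv ℝ (fun q : 𝔤 × V => q.1) 0 p = p.1 := by
    rw [show (fun q : 𝔤 × V => q.1) = Prod.fst from rfl, fderiv_fst]; rfl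
  have e2 : fderiv ℝ (fun q : 𝔤 × V => q.2) 0 p = p.2 := by
    rw [show (fun q : 𝔤 × V => q.2) = Prod.snd from rfl, fderiv_snd]; rfl
  rw [e1, e2, Prod.fst_add]
  simp [hT.symm_left]

/-- The mixed second derivative of the coset action, modulo the tangent space of the subgroup. -/
lemma exists_secondFDeriv_cosetAction (a : 𝔤) (y : V) : ∃ n : 𝔥,
    loopM G.mul a (fderiv ℝ s 0 y) = secondFDeriv s 0 (e.symm a).1 y
      + fderiv ℝ s 0 (secondFDeriv (fun q : 𝔤 × V => G.cosetAction s k q.1 q.2) 0 (a, 0) (0, y))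
      + loopM G.mul (fderiv ℝ s 0 y) (fderiv ℝ k 0 (e.symm a).2) + fderiv ℝ k 0 n := by
  have h1 : (1 : WithTop ℕ∞) ≤ 3 := by norm_num
  have h2 : (2 : WithTop ℕ∞) ≤ 3 := by norm_num
  obtain ⟨χ, hπ, hχ, hfac, huniq⟩ := hT.exists_factorization G
  have hχ0 : χ 0 = 0 := by
    have := huniq.self_of_nhds.2
    simpa [hT.left_zero, hT.right_zero, G.mul_zero_zero] using this
  have hs : ContDiffAt ℝ 3 (fun q : 𝔤 × V => s q.2) 0 :=
    hT.contDiffAt_left.comp_at_eq contDiffAt_snd rfl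
  have hr := G.contDiffAt_mul_comp (x := (0 : 𝔤 × V)) contDiffAt_fst hs rfl hT.left_zero
  have hr0 : G.mul (0 : 𝔤 × V).1 (s (0 : 𝔤 × V).2) = 0 := by
    simp [hT.left_zero, G.mul_zero_zero]
  have hA := hT.contDiffAt_cosetAction (G := G)
  have hA0 : G.cosetAction s k (0 : 𝔤 × V).1 (0 : 𝔤 × V).2 = 0 := by
    simp [cosetAction, hT.left_zero, G.mul_zero_zero, hT.cosetProj_zero]
  set h : 𝔤 × V → 𝔥 := fun q => χ (G.mul q.1 (s q.2)) with hh
  have hh0 : h 0 = 0 := by rw [hh]; dsimp only; rw [hr0, hχ0]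
  have hhc : ContDiffAt ℝ 3 h 0 := hχ.comp_at_eq hr hr0
  have hsA : ContDiffAt ℝ 3 (fun q : 𝔤 × V => s (G.cosetAction s k q.1 q.2)) 0 :=
    hT.contDiffAt_left.comp_at_eq hA hA0
  have hkh : ContDiffAt ℝ 3 (fun q => k (h q)) 0 := hT.contDiffAt_right.comp_at_eq hhc hh0
  have hrt : Tendsto (fun q : 𝔤 × V => G.mul q.1 (s q.2)) (𝓝 0) (𝓝 0) := by
    have := hr.continuousAt
    rwa [ContinuousAt, hr0] at this
  -- The product `a · s y` is factored into a section part, which is the action, and a transversal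
  -- part `k (h (a, y))`; both sides are then differentiated twice.
  have hev : (fun q : 𝔤 × V => G.mul (s (G.cosetAction s k q.1 q.2)) (k (h q)))
      =ᶠ[𝓝 0] fun q => G.mul q.1 (s q.2) := hrt.eventually hfac
  have e1 : ∀ p, fderiv ℝ (fun q : 𝔤 × V => q.1) 0 p = p.1 := by
    intro p
    rw [show (fun q : 𝔤 × V => q.1) = Prod.fst from rfl, fderiv_fst]; rfl
  have e2 : ∀ p, fderiv ℝ (fun q : 𝔤 × V => s q.2) 0 p = fderiv ℝ s 0 p.2 := by
    intro p
    rw [fderiv_comp_apply (f := fun q : 𝔤 × V => q.2) (x := 0)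
      (hT.contDiffAt_left.of_le h1) contDiffAt_snd p,
      show (fun q : 𝔤 × V => q.2) = Prod.snd from rfl, fderiv_snd]; rfl
  have e3 : ∀ p, fderiv ℝ (fun q : 𝔤 × V => s (G.cosetAction s k q.1 q.2)) 0 p
      = fderiv ℝ s 0 ((e.symm p.1).1 + p.2) := by
    intro p
    rw [fderiv_comp_apply (f := fun q : 𝔤 × V => G.cosetAction s k q.1 q.2) (x := 0)
      (by rw [hA0]; exact hT.contDiffAt_left.of_le h1) (hA.of_le h1) p, hA0,
      hT.fderiv_cosetAction]
  have hd1 : ∀ p, fderiv ℝ (fun q => k (h q)) 0 p = fderiv ℝ k 0 (fderiv ℝ h 0 p) := by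
    intro p
    rw [fderiv_comp_apply (by rw [hh0]; exact hT.contDiffAt_right.of_le h1) (hhc.of_le h1), hh0]
  have e4 : ∀ p : 𝔤 × V, fderiv ℝ h 0 p = (e.symm p.1).2 := by
    intro p
    have hd := hev.fderiv_eq (𝕜 := ℝ)
    have := congrArg (fun T : 𝔤 × V →L[ℝ] 𝔤 => (e.symm (T p)).2) hd
    simp only [G.fderiv_mul_comp hsA hkh (by rw [hA0, hT.left_zero]) (by rw [hh0, hT.right_zero]),
      G.fderiv_mul_comp contDiffAt_fst hs rfl hT.left_zero, e1, e2, e3, hd1, map_add,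
      hT.symm_left, hT.symm_right] at this
    simpa using this
  have hD := congrArg (fun T => T ((a, 0) : 𝔤 × V) ((0, y) : 𝔤 × V)) hev.secondFDeriv_eq
  have z1 : secondFDeriv (fun q : 𝔤 × V => q.1) 0 = 0 :=
    (ContinuousLinearMap.fst ℝ 𝔤 V).secondFDeriv_eq_zero 0
  have z2 : secondFDeriv (fun q : 𝔤 × V => s q.2) 0 ((a, 0) : 𝔤 × V) ((0, y) : 𝔤 × V) = 0 := by
    have := secondFDeriv_comp_clm (f := s) (ContinuousLinearMap.snd ℝ 𝔤 V) (y := 0)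
      (hT.contDiffAt_left.of_le h2) (map_zero _) ((a, 0) : 𝔤 × V) ((0, y) : 𝔤 × V)
    simpa using this
  simp only [G.secondFDeriv_mul_comp hsA hkh (by rw [hA0, hT.left_zero])
      (by rw [hh0, hT.right_zero]),
    G.secondFDeriv_mul_comp contDiffAt_fst hs rfl hT.left_zero, e1, e2, e3, hd1, e4,
    z1, z2,
    secondFDeriv_comp_apply (f := fun q : 𝔤 × V => G.cosetAction s k q.1 q.2) (x := 0)
      (by rw [hA0]; exact hT.contDiffAt_left.of_le h2) (hA.of_le h2),
    secondFDeriv_comp_apply (f := h) (x := 0)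
      (by rw [hh0]; exact hT.contDiffAt_right.of_le h2) (hhc.of_le h2), hA0, hh0,
    hT.fderiv_cosetAction] at hD
  -- The second derivative of `h` enters only through the tangent space of `k`. The second
  -- derivative of `k` does not contribute, since the first derivative of `h` vanishes in section
  -- directions.
  refine ⟨secondFDeriv h 0 (a, 0) (0, y), ?_⟩
  simp only [map_zero, Prod.fst_zero, Prod.snd_zero, add_zero, zero_add, _root_.zero_apply,
    IsLocalLoop.loopM_zero_right] at hD
  rw [← hD]
  abel

/-- The mixed second derivative of the loop is that of the action. -/
lemma loopM_cosetLoop (ξ η : V) : loopM (G.cosetLoop s k) ξ η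
    = secondFDeriv (fun q : 𝔤 × V => G.cosetAction s k q.1 q.2) 0 (fderiv ℝ s 0 ξ, 0) (0, η) := by
  have h1 : (1 : WithTop ℕ∞) ≤ 3 := by norm_num
  have h2 : (2 : WithTop ℕ∞) ≤ 3 := by norm_num
  have hs : ContDiffAt ℝ 3 (fun q : V × V => s q.1) 0 :=
    hT.contDiffAt_left.comp_at_eq contDiffAt_fst rfl
  have hz : ((s (0 : V × V).1, (0 : V × V).2) : 𝔤 × V) = 0 := by simp [hT.left_zero]
  have h := secondFDeriv_comp_apply (g := fun q : 𝔤 × V => G.cosetAction s k q.1 q.2)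
    (f := fun q : V × V => (s q.1, q.2)) (x := 0)
    (by rw [hz]; exact (hT.contDiffAt_cosetAction (G := G)).of_le h2)
    ((hs.prodMk contDiffAt_snd).of_le h2) (ξ, 0) (0, η)
  have e1 : ∀ p, fderiv ℝ (fun q : V × V => s q.1) 0 p = fderiv ℝ s 0 p.1 := by
    intro p
    rw [fderiv_comp_apply (f := fun q : V × V => q.1) (x := 0)
      (hT.contDiffAt_left.of_le h1) contDiffAt_fst p,
      show (fun q : V × V => q.1) = Prod.fst from rfl, fderiv_fst]; rfl
  have e2 : ∀ p, fderiv ℝ (fun q : V × V => q.2) 0 p = p.2 := by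
    intro p
    rw [show (fun q : V × V => q.2) = Prod.snd from rfl, fderiv_snd]; rfl
  have z1 : secondFDeriv (fun q : V × V => q.2) 0 = 0 :=
    (ContinuousLinearMap.snd ℝ V V).secondFDeriv_eq_zero 0
  have z2 : secondFDeriv (fun q : V × V => s q.1) 0 ((ξ, 0) : V × V) ((0, η) : V × V) = 0 := by
    have := secondFDeriv_comp_clm (f := s) (ContinuousLinearMap.fst ℝ V V) (y := 0)
      (hT.contDiffAt_left.of_le h2) (map_zero _) (ξ, 0) (0, η)
    simpa using this
  simp only [fderiv_prodMk_apply (hs.of_le h1) contDiffAt_snd,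
    secondFDeriv_prodMk_apply (hs.of_le h2) contDiffAt_snd, e1, e2, z1, z2, hz] at h
  simpa [← Prod.zero_eq_mk, loopM, cosetLoop, cosetAction] using h

/-- The torsion tensor at the neutral element of a coset loop. -/
lemma chernTorsion_cosetLoop (ξ η : V) : chernTorsion (G.cosetLoop s k) 0 ξ η
    = -((1 / 2 : ℝ) • (e.symm (G.bracket (fderiv ℝ s 0 ξ) (fderiv ℝ s 0 η))).1) := by
  obtain ⟨n₁, h₁⟩ := hT.exists_secondFDeriv_cosetAction (G := G) (fderiv ℝ s 0 ξ) η
  obtain ⟨n₂, h₂⟩ := hT.exists_secondFDeriv_cosetAction (G := G) (fderiv ℝ s 0 η) ξ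
  rw [← hT.loopM_cosetLoop, hT.symm_left] at h₁ h₂
  -- By this symmetry the second-order shape of the section disappears from the antisymmetrised
  -- relation, leaving the bracket modulo the tangent space of `k`.
  have hsym := (hT.contDiffAt_left.of_le (by norm_num : (2 : WithTop ℕ∞) ≤ 3)).secondFDeriv_symm ξ η
  simp only [map_zero, IsLocalLoop.loopM_zero_right, add_zero] at h₁ h₂
  have hb : G.bracket (fderiv ℝ s 0 ξ) (fderiv ℝ s 0 η)
      = fderiv ℝ s 0 (loopM (G.cosetLoop s k) ξ η - loopM (G.cosetLoop s k) η ξ)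
        + fderiv ℝ k 0 (n₁ - n₂) := by
    rw [bracket_eq, h₁, h₂, hsym, map_sub, map_sub]; abel
  rw [hT.isLocalLoop.chernTorsion_zero, hb, map_add, hT.symm_left, hT.symm_right]
  simp

end IsTransversal

end LocalLieGroup

/-! ### The action law when the transversal submanifold is a local subgroup. -/

namespace LocalLieGroup

variable {𝔤 : Type*} [NormedAddCommGroup 𝔤] [NormedSpace ℝ 𝔤] {G : LocalLieGroup 𝔤}
  {V 𝔥 : Submodule ℝ 𝔤}

namespace IsTransversal

variable [FiniteDimensional ℝ 𝔤]

/-- When the second submanifold is a local subgroup, left translations act on the section. -/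
lemma cosetAction_mul {s : V → 𝔤} {e : (V × 𝔥) ≃L[ℝ] 𝔤}
    (hT : IsTransversal s (fun h : 𝔥 => (h : 𝔤)) e) (h𝔥 : G.IsLocalSubgroup 𝔥) :
    ∀ᶠ p in 𝓝 (0 : 𝔤 × 𝔤 × V),
      G.cosetAction s (fun h : 𝔥 => (h : 𝔤)) (G.mul p.1 p.2.1) p.2.2
        = G.cosetAction s (fun h : 𝔥 => (h : 𝔤)) p.1
          (G.cosetAction s (fun h : 𝔥 => (h : 𝔤)) p.2.1 p.2.2) := by
  set k : 𝔥 → 𝔤 := fun h => (h : 𝔤) with hk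
  obtain ⟨χ, hπ, hχ, hfac, huniq⟩ := hT.exists_factorization G
  have hkd : ∀ h : 𝔥, fderiv ℝ k 0 h = h := fun h => by
    rw [show k = 𝔥.subtypeL from rfl, ContinuousLinearMap.fderiv]; rfl
  have hmul : ∀ {f g : 𝔤 × 𝔤 × V → 𝔤}, Tendsto f (𝓝 0) (𝓝 0) → Tendsto g (𝓝 0) (𝓝 0) →
      Tendsto (fun p => G.mul (f p) (g p)) (𝓝 0) (𝓝 0) := by
    intro f g hf hg
    have hc : Tendsto (fun q : 𝔤 × 𝔤 => G.mul q.1 q.2) (𝓝 0) (𝓝 0) := by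
      have := G.isLocalLoop.contDiffAt.continuousAt
      rwa [ContinuousAt, show G.mul (0 : 𝔤 × 𝔤).1 (0 : 𝔤 × 𝔤).2 = 0 from G.mul_zero_zero] at this
    exact hc.comp (hf.prodMk_nhds hg)
  have hst : Tendsto s (𝓝 0) (𝓝 0) := by
    simpa [ContinuousAt, hT.left_zero] using hT.contDiffAt_left.continuousAt
  have hπt : Tendsto (G.cosetProj s k) (𝓝 0) (𝓝 0) := by
    simpa [ContinuousAt, hT.cosetProj_zero] using hπ.continuousAt
  have hχt : Tendsto χ (𝓝 0) (𝓝 0) := by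
    have h0 : χ 0 = 0 := by
      simpa [hT.left_zero, hT.right_zero, G.mul_zero_zero] using huniq.self_of_nhds.2
    simpa [ContinuousAt, h0] using hχ.continuousAt
  have ta : Tendsto (fun p : 𝔤 × 𝔤 × V => p.1) (𝓝 0) (𝓝 0) := continuous_fst.tendsto 0
  have tb : Tendsto (fun p : 𝔤 × 𝔤 × V => p.2.1) (𝓝 0) (𝓝 0) :=
    (continuous_fst.comp continuous_snd).tendsto 0
  have ty : Tendsto (fun p : 𝔤 × 𝔤 × V => s p.2.2) (𝓝 0) (𝓝 0) :=
    hst.comp ((continuous_snd.comp continuous_snd).tendsto 0)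
  have tg := hmul tb ty
  have tsg := hst.comp (hπt.comp tg)
  have tcg : Tendsto (fun p : 𝔤 × 𝔤 × V => χ (G.mul p.2.1 (s p.2.2))) (𝓝 0) (𝓝 0) := hχt.comp tg
  have tkg : Tendsto (fun p : 𝔤 × 𝔤 × V => (χ (G.mul p.2.1 (s p.2.2)) : 𝔤)) (𝓝 0) (𝓝 0) := by
    have : Tendsto k (𝓝 0) (𝓝 0) := 𝔥.subtypeL.continuous.tendsto' 0 0 (map_zero _)
    exact this.comp tcg
  have tg2 := hmul ta tsg
  have tsg2 := hst.comp (hπt.comp tg2)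
  have tcg2 := hχt.comp tg2
  have tkg2 : Tendsto (fun p : 𝔤 × 𝔤 × V => (χ (G.mul p.1
      (s (G.cosetProj s k (G.mul p.2.1 (s p.2.2))))) : 𝔤)) (𝓝 0) (𝓝 0) := by
    have : Tendsto k (𝓝 0) (𝓝 0) := 𝔥.subtypeL.continuous.tendsto' 0 0 (map_zero _)
    exact this.comp tcg2
  have th3 := hmul tkg2 tkg
  -- Uniqueness of the factorisation needs a small element of the type `𝔥`, while the product of the
  -- two subgroup factors lies in `𝔥` only near the origin; its `𝔥`-coordinate serves as that
  -- element.
  have tP : Tendsto (fun w => (e.symm w).2) (𝓝 0) (𝓝 0) :=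
    (continuous_snd.comp e.symm.continuous).tendsto' 0 0 (by simp)
  -- Write `b y = s₁ h₁` and `a s₁ = s₂ h₂`. Then `(a b) y = s₂ (h₂ h₁)` with `h₂ h₁` in the
  -- subgroup, so uniqueness gives the section part `s₂`.
  filter_upwards [(ta.prodMk_nhds (tb.prodMk_nhds ty)).eventually G.mul_assoc, tg.eventually hfac,
    (ta.prodMk_nhds (tsg.prodMk_nhds tkg)).eventually G.mul_assoc, tg2.eventually hfac,
    (tsg2.prodMk_nhds (tkg2.prodMk_nhds tkg)).eventually G.mul_assoc,
    (tcg2.prodMk_nhds tcg).eventually h𝔥,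
    ((hπt.comp tg2).prodMk_nhds (tP.comp th3)).eventually huniq] with p h1 h2 h3 h4 h5 h6 h7
  simp only [Function.comp_apply] at h1 h2 h3 h4 h5 h6 h7
  have h8 : ∀ w ∈ 𝔥, k (e.symm w).2 = w := by
    intro w hw
    have := hT.symm_right ⟨w, hw⟩
    rw [hkd] at this
    rw [this]
  simp only [cosetAction]
  rw [h1]
  conv_lhs => rw [← h2, ← h3, ← h4, h5, ← h8 _ h6]
  exact h7.1

/-- The third derivatives of the loop in terms of those of the action. -/
lemma thirdFDeriv_cosetLoop {s : V → 𝔤} {k : 𝔥 → 𝔤} {e : (V × 𝔥) ≃L[ℝ] 𝔤}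
    (hT : IsTransversal s k e) (ξ η ζ : V) :
    thirdFDeriv (fun q : V × V => G.cosetLoop s k q.1 q.2) 0 (ξ, 0) (η, 0) (0, ζ)
        = thirdFDeriv (fun q : 𝔤 × V => G.cosetAction s k q.1 q.2) 0
            (fderiv ℝ s 0 ξ, 0) (fderiv ℝ s 0 η, 0) (0, ζ)
          + secondFDeriv (fun q : 𝔤 × V => G.cosetAction s k q.1 q.2) 0
            (secondFDeriv s 0 ξ η, 0) (0, ζ) ∧
    thirdFDeriv (fun q : V × V => G.cosetLoop s k q.1 q.2) 0 (ξ, 0) (0, η) (0, ζ)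
        = thirdFDeriv (fun q : 𝔤 × V => G.cosetAction s k q.1 q.2) 0
            (fderiv ℝ s 0 ξ, 0) (0, η) (0, ζ) := by
  have h1 : (1 : WithTop ℕ∞) ≤ 3 := by norm_num
  have h2 : (2 : WithTop ℕ∞) ≤ 3 := by norm_num
  have hs : ContDiffAt ℝ 3 (fun q : V × V => s q.1) 0 :=
    hT.contDiffAt_left.comp_at_eq contDiffAt_fst rfl
  have hz : ((s (0 : V × V).1, (0 : V × V).2) : 𝔤 × V) = 0 := by simp [hT.left_zero]
  have h := fun u v w => thirdFDeriv_comp_apply (g := fun q : 𝔤 × V => G.cosetAction s k q.1 q.2)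
    (f := fun q : V × V => (s q.1, q.2)) (x := 0)
    (by rw [hz]; exact (hT.contDiffAt_cosetAction (G := G)))
    (hs.prodMk contDiffAt_snd) u v w
  have e1 : ∀ p, fderiv ℝ (fun q : V × V => s q.1) 0 p = fderiv ℝ s 0 p.1 := by
    intro p
    rw [fderiv_comp_apply (f := fun q : V × V => q.1) (x := 0)
      (hT.contDiffAt_left.of_le h1) contDiffAt_fst p,
      show (fun q : V × V => q.1) = Prod.fst from rfl, fderiv_fst]; rfl
  have e2 : ∀ p, fderiv ℝ (fun q : V × V => q.2) 0 p = p.2 := by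
    intro p
    rw [show (fun q : V × V => q.2) = Prod.snd from rfl, fderiv_snd]; rfl
  have z1 : secondFDeriv (fun q : V × V => q.2) 0 = 0 :=
    (ContinuousLinearMap.snd ℝ V V).secondFDeriv_eq_zero 0
  have z1' : thirdFDeriv (fun q : V × V => q.2) 0 = 0 :=
    (ContinuousLinearMap.snd ℝ V V).thirdFDeriv_eq_zero 0
  have z2 : ∀ u v : V × V, secondFDeriv (fun q : V × V => s q.1) 0 u v
      = secondFDeriv s 0 u.1 v.1 := secondFDeriv_comp_clm (f := s)
    (ContinuousLinearMap.fst ℝ V V) (y := 0) (hT.contDiffAt_left.of_le h2) (map_zero _)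
  have z3 : ∀ u v w : V × V, thirdFDeriv (fun q : V × V => s q.1) 0 u v w
      = thirdFDeriv s 0 u.1 v.1 w.1 := thirdFDeriv_comp_clm (f := s)
    (ContinuousLinearMap.fst ℝ V V) (y := 0) hT.contDiffAt_left (map_zero _)
  simp only [fderiv_prodMk_apply (hs.of_le h1) contDiffAt_snd,
    secondFDeriv_prodMk_apply (hs.of_le h2) contDiffAt_snd,
    thirdFDeriv_prodMk_apply hs contDiffAt_snd, e1, e2, z1, z1', z2, z3, hz] at h
  refine ⟨(h (ξ, 0) (η, 0) (0, ζ)).trans ?_, (h (ξ, 0) (0, η) (0, ζ)).trans ?_⟩ <;>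
  simp [← Prod.zero_eq_mk]

end IsTransversal

/-! ### The loop of the section in normal coordinates and its covariant derivatives. -/

section Section

variable [FiniteDimensional ℝ 𝔤] {φ : V → 𝔥}

/-- The splitting of the Lie algebra as a continuous linear equivalence. -/
noncomputable def splitting (hV : IsCompl V 𝔥) : (V × 𝔥) ≃L[ℝ] 𝔤 :=
  (Submodule.prodEquivOfIsCompl V 𝔥 hV).toContinuousLinearEquiv

lemma splitting_apply (hV : IsCompl V 𝔥) (p : V × 𝔥) :
    splitting hV p = (p.1 : 𝔤) + p.2 := rfl

lemma splitting_symm_fst (hV : IsCompl V 𝔥) (w : 𝔤) :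
    ((splitting hV).symm w).1 = V.projectionOnto 𝔥 hV w := by
  obtain ⟨p, rfl⟩ := (splitting hV).surjective w
  rw [ContinuousLinearEquiv.symm_apply_apply, splitting_apply]
  simp

omit [FiniteDimensional ℝ 𝔤] in
lemma hasFDerivAt_sectionMap (hφ : ContDiffAt ℝ 3 φ 0) (hφ₁ : fderiv ℝ φ 0 = 0) :
    HasFDerivAt (sectionMap φ) V.subtypeL 0 := by
  have h := (hφ.differentiableAt (by norm_num)).hasFDerivAt
  rw [hφ₁] at h
  have h2 := V.subtypeL.hasFDerivAt (x := (0 : V)).add (𝔥.subtypeL.hasFDerivAt.comp (0 : V) h)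
  rw [ContinuousLinearMap.comp_zero, add_zero] at h2
  exact h2

omit [FiniteDimensional ℝ 𝔤] in
lemma contDiffAt_sectionMap (hφ : ContDiffAt ℝ 3 φ 0) : ContDiffAt ℝ 3 (sectionMap φ) 0 :=
  V.subtypeL.contDiff.contDiffAt.add (𝔥.subtypeL.contDiff.contDiffAt.comp 0 hφ)

omit [FiniteDimensional ℝ 𝔤] in
-- The factor 2 undoes the one half in `quadraticPart`.
lemma secondFDeriv_sectionMap (hφ : ContDiffAt ℝ 3 φ 0) (ξ η : V) :
    secondFDeriv (sectionMap φ) 0 ξ η = (2 : ℝ) • (quadraticPart φ ξ η : 𝔤) := by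
  have h1 : (1 : WithTop ℕ∞) ≤ 3 := by norm_num
  have h2 : (2 : WithTop ℕ∞) ≤ 3 := by norm_num
  let L : V × 𝔥 →L[ℝ] 𝔤 := V.subtypeL.coprod 𝔥.subtypeL
  have h := secondFDeriv_clm_comp (f := fun ξ : V => (ξ, φ ξ)) L (x := 0)
    (contDiffAt_id.prodMk (hφ.of_le h2)) ξ η
  have hz : secondFDeriv (fun ξ : V => ξ) 0 = 0 :=
    (ContinuousLinearMap.id ℝ V).secondFDeriv_eq_zero 0
  rw [secondFDeriv_prodMk_apply (f := fun ξ : V => ξ) contDiffAt_id (hφ.of_le h2), hz] at h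
  refine h.trans ?_
  simp [L, quadraticPart, secondFDeriv]

omit [FiniteDimensional ℝ 𝔤] in
lemma quadraticPart_symm (hφ : ContDiffAt ℝ 3 φ 0) (ξ η : V) :
    quadraticPart φ ξ η = quadraticPart φ η ξ := by
  have := (hφ.of_le (by norm_num : (2 : WithTop ℕ∞) ≤ 3)).secondFDeriv_symm ξ η
  simp only [quadraticPart]
  exact congrArg _ this

variable (hV : IsCompl V 𝔥) (hφ : ContDiffAt ℝ 3 φ 0) (hφ₀ : φ 0 = 0) (hφ₁ : fderiv ℝ φ 0 = 0)

omit [FiniteDimensional ℝ 𝔤] in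
include hφ₀ in
lemma sectionMap_zero : sectionMap φ 0 = 0 := by simp [sectionMap, hφ₀]

include hφ hφ₀ hφ₁ in
lemma isTransversal_section :
    IsTransversal (sectionMap φ) (fun h : 𝔥 => (h : 𝔤)) (splitting hV) where
  contDiffAt_left := contDiffAt_sectionMap hφ
  contDiffAt_right := 𝔥.subtypeL.contDiff.contDiffAt
  left_zero := sectionMap_zero hφ₀
  right_zero := rfl
  equiv_apply p := by
    rw [(hasFDerivAt_sectionMap hφ hφ₁).fderiv, show (fun h : 𝔥 => (h : 𝔤)) = 𝔥.subtypeL from rfl,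
      ContinuousLinearMap.fderiv]
    rfl

include hφ hφ₀ hφ₁ in
/-- The mixed second derivative of the action on the section. -/
lemma secondFDeriv_sectionAction (hG : G.IsNormal) (a : 𝔤) (y : V) :
    secondFDeriv (fun q : 𝔤 × V => G.cosetAction (sectionMap φ) (fun h : 𝔥 => (h : 𝔤)) q.1 q.2) 0
      (a, 0) (0, y) = V.projectionOnto 𝔥 hV (G.bracket a y)
        - (1 / 2 : ℝ) • V.projectionOnto 𝔥 hV (G.bracket (V.projectionOnto 𝔥 hV a) y) := by
  have hT := isTransversal_section hV hφ hφ₀ hφ₁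
  obtain ⟨n, hn⟩ := hT.exists_secondFDeriv_cosetAction (G := G) a y
  have hkd : ∀ h : 𝔥, fderiv ℝ (fun h : 𝔥 => (h : 𝔤)) 0 h = h := fun h => by
    rw [show (fun h : 𝔥 => (h : 𝔤)) = 𝔥.subtypeL from rfl, ContinuousLinearMap.fderiv]; rfl
  rw [(hasFDerivAt_sectionMap hφ hφ₁).fderiv, hkd, hkd, secondFDeriv_sectionMap hφ,
    hG.loopM_eq, hG.loopM_eq] at hn
  have ha : (((splitting hV).symm a).2 : 𝔤) = a - V.projectionOnto 𝔥 hV a := by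
    have := splitting_apply hV ((splitting hV).symm a)
    rw [ContinuousLinearEquiv.apply_symm_apply, splitting_symm_fst] at this
    rw [eq_sub_iff_add_eq, add_comm]; exact this.symm
  -- Projecting removes the unknown `n` and the quadratic part of `φ`, both of which lie in `𝔥`.
  have hn' := congrArg (V.projectionOnto 𝔥 hV) hn
  rw [ha] at hn'
  simp only [map_add, map_smul, Submodule.subtypeL_apply, Submodule.projectionOnto_apply_left,
    Submodule.projectionOnto_apply_right, smul_zero, zero_add, add_zero] at hn'
  rw [G.bracket_swap y, G.bracket_sub_left, map_neg, map_sub] at hn'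
  rw [← sub_eq_iff_eq_add] at hn'
  rw [← hn']
  module

include hφ hφ₀ hφ₁ in
lemma loopM_sectionLoop (hG : G.IsNormal) (ξ η : V) : loopM (G.sectionLoop φ) ξ η
    = (1 / 2 : ℝ) • V.projectionOnto 𝔥 hV (G.bracket ξ η) := by
  have hT := isTransversal_section hV hφ hφ₀ hφ₁
  rw [sectionLoop, hT.loopM_cosetLoop, secondFDeriv_sectionAction hV hφ hφ₀ hφ₁ hG,
    (hasFDerivAt_sectionMap hφ hφ₁).fderiv]
  simp only [Submodule.subtypeL_apply, Submodule.projectionOnto_apply_left]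
  module

include hφ hφ₀ hφ₁ in
/-- The third order consequence of the action law for the section. -/
lemma thirdFDeriv_sectionAction (h𝔥 : G.IsLocalSubgroup 𝔥) (a b : 𝔤) (y : V) :
    letI f := fun q : 𝔤 × V => G.cosetAction (sectionMap φ) (fun h : 𝔥 => (h : 𝔤)) q.1 q.2
    secondFDeriv f 0 (loopM G.mul a b, 0) (0, y) + thirdFDeriv f 0 (a, 0) (b, 0) (0, y)
    = secondFDeriv f 0 (a, 0) (0, secondFDeriv f 0 (b, 0) (0, y))
      + thirdFDeriv f 0 (a, 0) (0, V.projectionOnto 𝔥 hV b) (0, y) := by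
  have hT := isTransversal_section hV hφ hφ₀ hφ₁
  have h := G.isLocalLoop.thirdFDeriv_action hT.contDiffAt_cosetAction hT.cosetAction_zero_left
    (hT.cosetAction_mul h𝔥) a b y
  rw [hT.fderiv_cosetAction, splitting_symm_fst] at h
  simpa using h

include hφ hφ₀ hφ₁ in
-- The action law at `(η, ξ; ζ)` and at `(ξ, η; ζ)` contains the same derivative with two group
-- directions. Their difference therefore gives the required xyy difference in terms of second
-- derivatives only.
lemma nablaTwoTorsion_sectionLoop (hG : G.IsNormal) (h𝔥 : G.IsLocalSubgroup 𝔥) (ξ η ζ : V) :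
    nablaTwoTorsion (G.sectionLoop φ) 0 ξ η ζ
      = -((1 / 2 : ℝ) • V.projectionOnto 𝔥 hV (G.bracket (G.bracket ξ η) ζ))
        + (1 / 2 : ℝ) • V.projectionOnto 𝔥 hV
          (G.bracket (V.projectionOnto 𝔥 hV (G.bracket ξ η)) ζ) := by
  have : CompleteSpace V := FiniteDimensional.complete ℝ V
  have hT := isTransversal_section hV hφ hφ₀ hφ₁
  have hL : IsLocalLoop (G.sectionLoop φ) := hT.isLocalLoop
  have hA := hT.contDiffAt_cosetAction (G := G)
  have k1 := thirdFDeriv_sectionAction (G := G) hV hφ hφ₀ hφ₁ h𝔥 (η : 𝔤) (ξ : 𝔤) ζ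
  have k2 := thirdFDeriv_sectionAction (G := G) hV hφ hφ₀ hφ₁ h𝔥 (ξ : 𝔤) (η : 𝔤) ζ
  rw [hA.thirdFDeriv_symm_left] at k1
  simp only [Submodule.projectionOnto_apply_left] at k1 k2
  rw [hL.nablaTwoTorsion_zero, hL.contDiffAt.thirdFDeriv_symm_left (0, ζ) (η, 0),
    hL.contDiffAt.thirdFDeriv_symm_left (0, ζ) (ξ, 0), hL.contDiffAt.thirdFDeriv_symm_right _ (0, ζ),
    hL.contDiffAt.thirdFDeriv_symm_right _ (0, ζ)]
  simp only [sectionLoop, (hT.thirdFDeriv_cosetLoop _ _ _).2, (hasFDerivAt_sectionMap hφ hφ₁).fderiv,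
    Submodule.subtypeL_apply]
  rw [← sub_eq_iff_eq_add'] at k1 k2
  rw [← k1, ← k2]
  change _ • (_ + loopM (G.sectionLoop φ) (loopM (G.sectionLoop φ) ξ η) ζ
    - loopM (G.sectionLoop φ) (loopM (G.sectionLoop φ) η ξ) ζ
    + loopM (G.sectionLoop φ) η (loopM (G.sectionLoop φ) ξ ζ)
    - loopM (G.sectionLoop φ) ξ (loopM (G.sectionLoop φ) η ζ)) = _
  simp only [secondFDeriv_sectionAction hV hφ hφ₀ hφ₁ hG, loopM_sectionLoop hV hφ hφ₀ hφ₁ hG,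
    hG.loopM_eq, bracket_smul_left, bracket_smul_right, map_smul, map_sub, Submodule.coe_smul,
    Submodule.coe_sub, Submodule.projectionOnto_apply_left, G.bracket_swap (η : 𝔤) (ξ : 𝔤),
    bracket_neg_left, map_neg, Submodule.coe_neg, bracket_sub_right]
  module

include hφ hφ₀ hφ₁ in
-- Now the action law is used at `(ζ, η; ξ)` and `(ζ, ξ; η)`, where the derivative with two section
-- directions is common and cancels. The xxy derivatives of the loop also involve the second
-- derivative of the section, and this brings in `quadraticPart φ`.
lemma nablaOneTorsion_sectionLoop (hG : G.IsNormal) (h𝔥 : G.IsLocalSubgroup 𝔥) (ξ η ζ : V) :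
    nablaOneTorsion (G.sectionLoop φ) 0 ξ η ζ
      = -((1 / 4 : ℝ) • V.projectionOnto 𝔥 hV (G.bracket (G.bracket ξ ζ) η))
        + (1 / 4 : ℝ) • V.projectionOnto 𝔥 hV
          (G.bracket (V.projectionOnto 𝔥 hV (G.bracket ξ ζ)) η)
        - V.projectionOnto 𝔥 hV (G.bracket (quadraticPart φ ξ ζ) η)
        + (1 / 4 : ℝ) • V.projectionOnto 𝔥 hV (G.bracket (G.bracket η ζ) ξ)
        - (1 / 4 : ℝ) • V.projectionOnto 𝔥 hV
          (G.bracket (V.projectionOnto 𝔥 hV (G.bracket η ζ)) ξ)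
        + V.projectionOnto 𝔥 hV (G.bracket (quadraticPart φ η ζ) ξ) := by
  have : CompleteSpace V := FiniteDimensional.complete ℝ V
  have hT := isTransversal_section hV hφ hφ₀ hφ₁
  have hL : IsLocalLoop (G.sectionLoop φ) := hT.isLocalLoop
  have hA := hT.contDiffAt_cosetAction (G := G)
  have k1 := thirdFDeriv_sectionAction (G := G) hV hφ hφ₀ hφ₁ h𝔥 (ζ : 𝔤) (η : 𝔤) ξ
  have k2 := thirdFDeriv_sectionAction (G := G) hV hφ hφ₀ hφ₁ h𝔥 (ζ : 𝔤) (ξ : 𝔤) η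
  simp only [Submodule.projectionOnto_apply_left] at k1 k2
  rw [hA.thirdFDeriv_symm_right _ (0, η)] at k1
  rw [← eq_sub_iff_add_eq'] at k1 k2
  rw [hL.nablaOneTorsion_zero]
  simp only [sectionLoop, (hT.thirdFDeriv_cosetLoop _ _ _).1, (hasFDerivAt_sectionMap hφ hφ₁).fderiv,
    Submodule.subtypeL_apply, secondFDeriv_sectionMap hφ]
  rw [k1, k2]
  change _ • (_ + loopM (G.sectionLoop φ) ζ (loopM (G.sectionLoop φ) ξ η)
    - loopM (G.sectionLoop φ) ζ (loopM (G.sectionLoop φ) η ξ)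
    - loopM (G.sectionLoop φ) (loopM (G.sectionLoop φ) ζ ξ) η
    + loopM (G.sectionLoop φ) (loopM (G.sectionLoop φ) ζ η) ξ) = _
  simp only [secondFDeriv_sectionAction hV hφ hφ₀ hφ₁ hG, loopM_sectionLoop hV hφ hφ₀ hφ₁ hG,
    hG.loopM_eq, bracket_smul_left, bracket_smul_right, map_smul, map_sub, Submodule.coe_smul,
    Submodule.coe_sub, Submodule.projectionOnto_apply_left, Submodule.projectionOnto_apply_right,
    G.bracket_swap (ζ : 𝔤) (ξ : 𝔤), G.bracket_swap (ζ : 𝔤) (η : 𝔤), quadraticPart_symm hφ ζ,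
    G.bracket_swap (η : 𝔤) (ξ : 𝔤), bracket_neg_right,
    bracket_neg_left, map_neg, Submodule.coe_neg, Submodule.coe_zero, bracket_sub_right]
  rw [show G.bracket 0 (ξ : 𝔤) = 0 by simpa using G.bracket_smul_left 0 0 (ξ : 𝔤),
    show G.bracket 0 (η : 𝔤) = 0 by simpa using G.bracket_smul_left 0 0 (η : 𝔤), map_zero]
  module

end Section

end LocalLieGroup

/-! ### Projections read off from a linear splitting. -/

section ProjAlong

variable {𝔤 : Type*} [NormedAddCommGroup 𝔤] [NormedSpace ℝ 𝔤] {V 𝔥 : Submodule ℝ 𝔤}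

lemma isCompl_range_of_equiv {A : V →L[ℝ] 𝔤} {B : 𝔥 →L[ℝ] 𝔤} (e : (V × 𝔥) ≃L[ℝ] 𝔤)
    (he : ∀ p, e p = A p.1 + B p.2) :
    IsCompl (LinearMap.range A.toLinearMap) (LinearMap.range B.toLinearMap) := by
  constructor
  · rw [Submodule.disjoint_def]
    rintro _ ⟨v, rfl⟩ ⟨h, hh⟩
    have : e (v, 0) = e (0, h) := by
      rw [he, he]; simpa using hh.symm
    have := congrArg Prod.fst (e.injective this)
    simp only at this
    simp [this]
  · rw [codisjoint_iff_le_sup]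
    intro w _
    obtain ⟨p, rfl⟩ := e.surjective w
    rw [he]
    exact Submodule.add_mem_sup ⟨p.1, rfl⟩ ⟨p.2, rfl⟩

lemma injective_of_equiv {A : V →L[ℝ] 𝔤} {B : 𝔥 →L[ℝ] 𝔤} (e : (V × 𝔥) ≃L[ℝ] 𝔤)
    (he : ∀ p, e p = A p.1 + B p.2) : Function.Injective A := by
  intro v v' h
  have : e (v, 0) = e (v', 0) := by rw [he, he]; simpa using h
  exact congrArg Prod.fst (e.injective this)

lemma projAlong_range_of_equiv {A : V →L[ℝ] 𝔤} {B : 𝔥 →L[ℝ] 𝔤} (e : (V × 𝔥) ≃L[ℝ] 𝔤)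
    (he : ∀ p, e p = A p.1 + B p.2) (w : 𝔤) :
    projAlong (LinearMap.range A.toLinearMap) (LinearMap.range B.toLinearMap) w
      = A (e.symm w).1 := by
  have hc := isCompl_range_of_equiv e he
  obtain ⟨p, rfl⟩ := e.surjective w
  rw [projAlong, dif_pos hc, ContinuousLinearEquiv.symm_apply_apply, he, map_add]
  have h1 := Submodule.projectionOnto_apply_left hc ⟨A p.1, p.1, rfl⟩
  have h2 := Submodule.projectionOnto_apply_right hc ⟨B p.2, p.2, rfl⟩
  simp only at h1 h2
  rw [h1, h2]
  simp

end ProjAlong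

/-! ### Conjugation, the adjoint action and conjugated subgroups. -/

namespace LocalLieGroup

variable {𝔤 : Type*} [NormedAddCommGroup 𝔤] [NormedSpace ℝ 𝔤] (G : LocalLieGroup 𝔤)
  {V 𝔥 : Submodule ℝ 𝔤}

section Adjoint

lemma contDiffAt_conj : ContDiffAt ℝ 3 (fun q : 𝔤 × 𝔤 => G.conj q.1 q.2) 0 :=
  G.contDiffAt_mul_comp G.isLocalLoop.contDiffAt
    (G.contDiffAt_inv.comp_at_eq contDiffAt_fst rfl) G.mul_zero_zero G.inv_zero

lemma conj_zero_right : ∀ᶠ g in 𝓝 (0 : 𝔤), G.conj g 0 = 0 := by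
  filter_upwards [G.mul_one, G.mul_inv] with g h1 h2
  rw [conj, h1, h2]

lemma fderiv_inv_fst (p : 𝔤 × 𝔤) : fderiv ℝ (fun q : 𝔤 × 𝔤 => G.inv q.1) 0 p = -p.1 := by
  have h1 : (1 : WithTop ℕ∞) ≤ 3 := by norm_num
  rw [fderiv_comp_apply (f := fun q : 𝔤 × 𝔤 => q.1) (x := 0) (G.contDiffAt_inv.of_le h1)
    contDiffAt_fst p, show (fun q : 𝔤 × 𝔤 => q.1) = Prod.fst from rfl, fderiv_fst]
  exact G.fderiv_inv p.1

lemma fderiv_conj (p : 𝔤 × 𝔤) : fderiv ℝ (fun q : 𝔤 × 𝔤 => G.conj q.1 q.2) 0 p = p.2 := by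
  rw [show (fun q : 𝔤 × 𝔤 => G.conj q.1 q.2)
      = fun q => G.mul ((fun q : 𝔤 × 𝔤 => G.mul q.1 q.2) q) ((fun q => G.inv q.1) q) from rfl,
    G.fderiv_mul_comp G.isLocalLoop.contDiffAt
    (G.contDiffAt_inv.comp_at_eq contDiffAt_fst rfl) G.mul_zero_zero G.inv_zero,
    G.fderiv_inv_fst, G.isLocalLoop.fderiv_zero]
  abel

/-- The factor `g h` contributes `loopM ζ h`, and the right factor `g⁻¹`, with derivative `-ζ`,
contributes `-loopM h ζ`. -/
lemma secondFDeriv_conj (ζ h : 𝔤) :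
    secondFDeriv (fun q : 𝔤 × 𝔤 => G.conj q.1 q.2) 0 (ζ, 0) (0, h) = G.bracket ζ h := by
  rw [show (fun q : 𝔤 × 𝔤 => G.conj q.1 q.2)
      = fun q => G.mul ((fun q : 𝔤 × 𝔤 => G.mul q.1 q.2) q) ((fun q => G.inv q.1) q) from rfl,
    G.secondFDeriv_mul_comp G.isLocalLoop.contDiffAt
    (G.contDiffAt_inv.comp_at_eq contDiffAt_fst rfl) G.mul_zero_zero G.inv_zero,
    G.fderiv_inv_fst, G.fderiv_inv_fst, G.isLocalLoop.fderiv_zero, G.isLocalLoop.fderiv_zero]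
  have hz := secondFDeriv_comp_clm (f := G.inv) (ContinuousLinearMap.fst ℝ 𝔤 𝔤) (y := 0)
    (G.contDiffAt_inv.of_le (by norm_num)) (map_zero _) (ζ, 0) (0, h)
  simp only [ContinuousLinearMap.coe_fst', map_zero] at hz
  rw [hz, bracket_eq]
  simp only [loopM, neg_zero, zero_add, add_zero, ← Prod.zero_eq_mk, map_zero]
  have := IsLocalLoop.loopM_neg_right (m := G.mul) h ζ
  rw [loopM, loopM] at this
  rw [this]
  abel

lemma eventually_contDiffAt_conj : ∀ᶠ g in 𝓝 (0 : 𝔤),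
    ContDiffAt ℝ 3 (fun q : 𝔤 × 𝔤 => G.conj q.1 q.2) (g, 0) := by
  have hc : ContinuousAt (fun g : 𝔤 => (g, (0 : 𝔤))) 0 := by fun_prop
  exact hc.eventually (G.contDiffAt_conj.eventually_contDiffAt (n := 3))

/-- The differential of the adjoint representation is the bracket. -/
lemma hasFDerivAt_Ad : ∃ S : 𝔤 →L[ℝ] 𝔤 →L[ℝ] 𝔤, HasFDerivAt G.Ad S 0 ∧
    ∀ ζ h, S ζ h = G.bracket ζ h := by
  have h2 : ContDiffAt ℝ 2 (fun q : 𝔤 × 𝔤 => G.conj q.1 q.2) 0 :=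
    G.contDiffAt_conj.of_le (by norm_num)
  have h := (h2.hasFDerivAt_fderiv.comp (f := fun g : 𝔤 => (g, (0 : 𝔤))) 0
    (hasFDerivAt_prodMk_left 0 0)).clm_comp
    (hasFDerivAt_const (ContinuousLinearMap.inr ℝ 𝔤 𝔤) (0 : 𝔤))
  refine ⟨_, h.congr_of_eventuallyEq ?_, fun ζ h => ?_⟩
  · filter_upwards [G.eventually_contDiffAt_conj] with g hg
    ext1 v
    exact fderiv_partial_right (f := G.conj) (p := (g, 0)) (hg.differentiableAt (by norm_num)) v
  · simpa using G.secondFDeriv_conj ζ h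

lemma Ad_zero : G.Ad 0 = ContinuousLinearMap.id ℝ 𝔤 := by
  ext1 v
  have := fderiv_partial_right (f := G.conj) (p := (0 : 𝔤 × 𝔤))
    (G.contDiffAt_conj.differentiableAt (by norm_num)) v
  rw [G.fderiv_conj] at this
  exact this

variable {G} in
lemma hasFDerivAt_bracket {X : Type*} [NormedAddCommGroup X] [NormedSpace ℝ X] {f g : X → 𝔤}
    {f' g' : X →L[ℝ] 𝔤} {x : X} (hf : HasFDerivAt f f' x) (hg : HasFDerivAt g g' x) :
    ∃ S : X →L[ℝ] 𝔤, HasFDerivAt (fun z => G.bracket (f z) (g z)) S x ∧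
      ∀ v, S v = G.bracket (f' v) (g x) + G.bracket (f x) (g' v) := by
  let D := secondFDeriv (fun q : 𝔤 × 𝔤 => G.mul q.1 q.2) 0
  have hl := fun {f : X → 𝔤} {f' : X →L[ℝ] 𝔤} (hf : HasFDerivAt f f' x) =>
    (ContinuousLinearMap.inl ℝ 𝔤 𝔤).hasFDerivAt.comp x hf
  have hr := fun {f : X → 𝔤} {f' : X →L[ℝ] 𝔤} (hf : HasFDerivAt f f' x) =>
    (ContinuousLinearMap.inr ℝ 𝔤 𝔤).hasFDerivAt.comp x hf
  have h1 := (D.hasFDerivAt.comp x (hl hf)).clm_apply (hr hg)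
  have h2 := (D.hasFDerivAt.comp x (hl hg)).clm_apply (hr hf)
  refine ⟨_, (h1.sub h2).congr_of_eventuallyEq (Eventually.of_forall fun z => ?_), fun v => ?_⟩
  · simp only [bracket_eq]; rfl
  · simp [bracket_eq, loopM, D]; abel

end Adjoint

variable {G} in
/-- The torsion of the loop of a section with respect to a conjugated subgroup. -/
lemma conjugate_torsion [FiniteDimensional ℝ 𝔤] {s : V → 𝔤} {g : 𝔤} (hs : ContDiffAt ℝ 3 s 0)
    (hs0 : s 0 = 0) (hg : ContDiffAt ℝ 3 (fun q : 𝔤 × 𝔤 => G.conj q.1 q.2) (g, 0))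
    (hg0 : G.conj g 0 = 0)
    (hinv : (fderiv ℝ s 0).comp (ContinuousLinearMap.fst ℝ V 𝔥)
      + (G.Ad g).comp (𝔥.subtypeL.comp (ContinuousLinearMap.snd ℝ V 𝔥))
      ∈ Set.range ((↑) : ((V × 𝔥) ≃L[ℝ] 𝔤) → (V × 𝔥) →L[ℝ] 𝔤)) :
    Function.Injective (fderiv ℝ s 0) ∧
    IsCompl (LinearMap.range (fderiv ℝ s 0).toLinearMap) (𝔥.map (G.Ad g).toLinearMap) ∧
    ∀ ξ η : V, chernTorsion (G.cosetLoop s (fun h : 𝔥 => G.conj g (h : 𝔤))) 0 ξ η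
        = -((1 / 2 : ℝ) • (((fderiv ℝ s 0).comp (ContinuousLinearMap.fst ℝ V 𝔥)
          + (G.Ad g).comp (𝔥.subtypeL.comp (ContinuousLinearMap.snd ℝ V 𝔥))).inverse
          (G.bracket (fderiv ℝ s 0 ξ) (fderiv ℝ s 0 η))).1) ∧
      fderiv ℝ s 0 (chernTorsion (G.cosetLoop s (fun h : 𝔥 => G.conj g (h : 𝔤))) 0 ξ η)
        = -((1 / 2 : ℝ) • projAlong (LinearMap.range (fderiv ℝ s 0).toLinearMap)
          (𝔥.map (G.Ad g).toLinearMap) (G.bracket (fderiv ℝ s 0 ξ) (fderiv ℝ s 0 η))) := by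
  obtain ⟨e, he⟩ := hinv
  have hcg : ContDiffAt ℝ 3 (G.conj g) 0 :=
    hg.comp_at_eq (f := fun h : 𝔤 => (g, h)) (contDiffAt_const.prodMk contDiffAt_id) rfl
  have he' : ∀ p, e p = fderiv ℝ s 0 p.1 + ((G.Ad g).comp 𝔥.subtypeL) p.2 := by
    intro p
    exact congrArg (fun T : (V × 𝔥) →L[ℝ] 𝔤 => T p) he
  have hk : ∀ h, fderiv ℝ (fun h : 𝔥 => G.conj g (h : 𝔤)) 0 h = ((G.Ad g).comp 𝔥.subtypeL) h := by
    intro h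
    have := fderiv_comp_apply (g := G.conj g) (f := 𝔥.subtypeL) (x := 0)
      (by rw [map_zero]; exact hcg.of_le (by norm_num)) 𝔥.subtypeL.contDiff.contDiffAt h
    rw [ContinuousLinearMap.fderiv, map_zero] at this
    exact this
  have hT : IsTransversal s (fun h : 𝔥 => G.conj g (h : 𝔤)) e :=
    { contDiffAt_left := hs
      contDiffAt_right := hcg.comp_at_eq 𝔥.subtypeL.contDiff.contDiffAt rfl
      left_zero := hs0
      right_zero := hg0
      equiv_apply := fun p => by rw [hk]; exact he' p }
  have hr : 𝔥.map (G.Ad g).toLinearMap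
      = LinearMap.range ((G.Ad g).comp 𝔥.subtypeL).toLinearMap := by
    ext w; simp
  rw [hr]
  -- The torsion is recorded twice: through `inverse`, a form that can be differentiated in a
  -- parameter, and through the intrinsic projection.
  refine ⟨injective_of_equiv e he', isCompl_range_of_equiv e he', fun ξ η => ⟨?_, ?_⟩⟩
  · rw [← he, ContinuousLinearMap.inverse_equiv, hT.chernTorsion_cosetLoop]; rfl
  · rw [hT.chernTorsion_cosetLoop, projAlong_range_of_equiv e he', map_neg, map_smul]

end LocalLieGroup

/-! ### First variation of the torsion of the conjugated-subgroup loops. -/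

namespace LocalLieGroup

variable {𝔤 : Type*} [NormedAddCommGroup 𝔤] [NormedSpace ℝ 𝔤] [FiniteDimensional ℝ 𝔤]
  {G : LocalLieGroup 𝔤} {V 𝔥 : Submodule ℝ 𝔤} {φ : V → 𝔥} (hV : IsCompl V 𝔥)
  (hφ : ContDiffAt ℝ 3 φ 0) (hφ₀ : φ 0 = 0) (hφ₁ : fderiv ℝ φ 0 = 0)

/-- If a family of splittings starts at the standard one, the projections along it are
differentiable, with the expected derivative. -/
lemma hasFDerivAt_splitting_inverse {X : Type*} [NormedAddCommGroup X] [NormedSpace ℝ X]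
    {A : X → V →L[ℝ] 𝔤} {A' : X →L[ℝ] V →L[ℝ] 𝔤} {B : X → 𝔤 →L[ℝ] 𝔤}
    {B' : X →L[ℝ] 𝔤 →L[ℝ] 𝔤} {w : X → 𝔤} {w' : X →L[ℝ] 𝔤}
    (hA : HasFDerivAt A A' 0) (hB : HasFDerivAt B B' 0) (hw : HasFDerivAt w w' 0)
    (hA0 : A 0 = V.subtypeL) (hB0 : B 0 = ContinuousLinearMap.id ℝ 𝔤) :
    (∀ᶠ x in 𝓝 (0 : X), (A x).comp (ContinuousLinearMap.fst ℝ V 𝔥)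
      + (B x).comp (𝔥.subtypeL.comp (ContinuousLinearMap.snd ℝ V 𝔥))
      ∈ Set.range ((↑) : ((V × 𝔥) ≃L[ℝ] 𝔤) → (V × 𝔥) →L[ℝ] 𝔤)) ∧
    ∃ S : X →L[ℝ] V, HasFDerivAt (fun x => -((1 / 2 : ℝ) •
      (((A x).comp (ContinuousLinearMap.fst ℝ V 𝔥)
      + (B x).comp (𝔥.subtypeL.comp (ContinuousLinearMap.snd ℝ V 𝔥))).inverse (w x)).1)) S 0 ∧
      ∀ v, S v = -((1 / 2 : ℝ) • V.projectionOnto 𝔥 hV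
        (w' v - A' v (V.projectionOnto 𝔥 hV (w 0))
          - B' v (w 0 - V.projectionOnto 𝔥 hV (w 0)))) := by
  have : CompleteSpace (V × 𝔥) := FiniteDimensional.complete ℝ _
  have hT := (hA.clm_comp (hasFDerivAt_const (ContinuousLinearMap.fst ℝ V 𝔥) 0)).add
    (hB.clm_comp (hasFDerivAt_const (𝔥.subtypeL.comp (ContinuousLinearMap.snd ℝ V 𝔥)) 0))
  have h0 : (A 0).comp (ContinuousLinearMap.fst ℝ V 𝔥)
      + (B 0).comp (𝔥.subtypeL.comp (ContinuousLinearMap.snd ℝ V 𝔥)) = splitting hV := by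
    rw [hA0, hB0]; rfl
  refine ⟨hT.continuousAt.eventually (?_ : _ ∈ 𝓝 ((A 0).comp (ContinuousLinearMap.fst ℝ V 𝔥)
      + (B 0).comp (𝔥.subtypeL.comp (ContinuousLinearMap.snd ℝ V 𝔥)))), ?_⟩
  · rw [h0]; exact (splitting hV).nhds
  -- The family of splittings equals the standard one at the origin, so `(T⁻¹ w)' = T⁻¹ (w' - T'
  -- (T⁻¹ w))`, where `T'` acts by `A'` on the `V`-part of `w 0` and by `B'` on its `𝔥`-part.
  obtain ⟨S, hS, hS'⟩ := hT.inverse_apply (splitting hV) h0 hw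
  have h := (((ContinuousLinearMap.fst ℝ V 𝔥).hasFDerivAt.comp (0 : X) hS).const_smul
    (1 / 2 : ℝ)).neg
  refine ⟨_, h, fun v => ?_⟩
  have hsnd : (((splitting hV).symm (w 0)).2 : 𝔤) = w 0 - V.projectionOnto 𝔥 hV (w 0) := by
    have := splitting_apply hV ((splitting hV).symm (w 0))
    rw [ContinuousLinearEquiv.apply_symm_apply, splitting_symm_fst] at this
    rw [eq_sub_iff_add_eq, add_comm]; exact this.symm
  simp only [_root_.neg_apply, _root_.smul_apply, ContinuousLinearMap.comp_apply, hS',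
    ContinuousLinearMap.coe_fst', splitting_symm_fst]
  rw [sub_sub]
  simp [hsnd, splitting_symm_fst]

section TorsionTwo

include hV hφ hφ₀ hφ₁

lemma eventually_torsionTwo : ∀ᶠ g in 𝓝 (0 : 𝔤),
    IsCompl V (𝔥.map (G.Ad g).toLinearMap) ∧ ∀ ξ η : V,
      G.torsionTwo φ g ξ η = -((1 / 2 : ℝ) • ((V.subtypeL.comp (ContinuousLinearMap.fst ℝ V 𝔥)
          + (G.Ad g).comp (𝔥.subtypeL.comp (ContinuousLinearMap.snd ℝ V 𝔥))).inverse
          (G.bracket ξ η)).1) ∧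
      (G.torsionTwo φ g ξ η : 𝔤)
        = -((1 / 2 : ℝ) • projAlong V (𝔥.map (G.Ad g).toLinearMap) (G.bracket ξ η)) := by
  obtain ⟨S, hS, -⟩ := G.hasFDerivAt_Ad
  have hs := (hasFDerivAt_sectionMap hφ hφ₁).fderiv
  have hev := (hasFDerivAt_splitting_inverse hV (hasFDerivAt_const V.subtypeL (0 : 𝔤)) hS
    (hasFDerivAt_const (0 : 𝔤) (0 : 𝔤)) rfl G.Ad_zero).1
  filter_upwards [hev, G.eventually_contDiffAt_conj, G.conj_zero_right] with g h1 h2 h3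
  have h := conjugate_torsion (contDiffAt_sectionMap hφ) (sectionMap_zero hφ₀) h2 h3
    (by rw [hs]; exact h1)
  rw [hs] at h
  have hr : LinearMap.range V.subtypeL.toLinearMap = V := V.range_subtype
  rw [hr] at h
  exact h.2

/-- The section and the bracket are fixed; only `Ad g` moves, and it acts on the `𝔥`-part of the
bracket. -/
lemma hasFDerivAt_torsionTwo (ξ η : V) : ∃ S : 𝔤 →L[ℝ] V,
    HasFDerivAt (fun g => G.torsionTwo φ g ξ η) S 0 ∧ ∀ ζ, S ζ =
      -((1 / 2 : ℝ) • V.projectionOnto 𝔥 hV (G.bracket (G.bracket ξ η) ζ))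
        + (1 / 2 : ℝ) • V.projectionOnto 𝔥 hV
          (G.bracket (V.projectionOnto 𝔥 hV (G.bracket ξ η)) ζ) := by
  obtain ⟨B', hB, hB'⟩ := G.hasFDerivAt_Ad
  obtain ⟨S, hS, hS'⟩ := (hasFDerivAt_splitting_inverse hV
    (hasFDerivAt_const V.subtypeL (0 : 𝔤)) hB
    (hasFDerivAt_const (G.bracket ξ η) (0 : 𝔤)) rfl G.Ad_zero).2
  refine ⟨S, hS.congr_of_eventuallyEq ?_, fun ζ => ?_⟩
  · filter_upwards [eventually_torsionTwo (G := G) hV hφ hφ₀ hφ₁] with g hg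
    exact (hg.2 ξ η).1
  · rw [hS', hB']
    simp only [_root_.zero_apply, sub_zero, zero_sub, G.bracket_swap ζ, bracket_sub_left,
      map_sub, neg_neg]
    module

end TorsionTwo

section TorsionOne

include hV hφ hφ₀ hφ₁

lemma contDiffAt_sectionMap_sectionLoop :
    ContDiffAt ℝ 3 (fun q : V × V => sectionMap φ (G.sectionLoop φ q.1 q.2)) 0 := by
  have hT := (isTransversal_section hV hφ hφ₀ hφ₁).isLocalLoop (G := G)
  exact (contDiffAt_sectionMap hφ).comp_at_eq hT.contDiffAt hT.right_neutral.self_of_nhds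

lemma fderiv_sectionMap_sectionLoop (p : V × V) :
    fderiv ℝ (fun q : V × V => sectionMap φ (G.sectionLoop φ q.1 q.2)) 0 p
      = (p.1 : 𝔤) + p.2 := by
  have hL : IsLocalLoop (G.sectionLoop φ) := (isTransversal_section hV hφ hφ₀ hφ₁).isLocalLoop
  have h0 : G.sectionLoop φ (0 : V × V).1 (0 : V × V).2 = 0 := hL.right_neutral.self_of_nhds
  have h1 : (1 : WithTop ℕ∞) ≤ 3 := by norm_num
  rw [fderiv_comp_apply (f := fun q : V × V => G.sectionLoop φ q.1 q.2)
    (by rw [h0]; exact (contDiffAt_sectionMap hφ).of_le h1) (hL.contDiffAt.of_le h1), h0,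
    hL.fderiv_zero, (hasFDerivAt_sectionMap hφ hφ₁).fderiv]
  rfl

lemma secondFDeriv_sectionMap_sectionLoop (hG : G.IsNormal) (u ξ : V) :
    secondFDeriv (fun q : V × V => sectionMap φ (G.sectionLoop φ q.1 q.2)) 0 (u, 0) (0, ξ)
      = (2 : ℝ) • (quadraticPart φ u ξ : 𝔤)
        + (1 / 2 : ℝ) • (V.projectionOnto 𝔥 hV (G.bracket u ξ) : 𝔤) := by
  have hL : IsLocalLoop (G.sectionLoop φ) := (isTransversal_section hV hφ hφ₀ hφ₁).isLocalLoop
  have h0 : G.sectionLoop φ (0 : V × V).1 (0 : V × V).2 = 0 := hL.right_neutral.self_of_nhds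
  have h2 : (2 : WithTop ℕ∞) ≤ 3 := by norm_num
  rw [secondFDeriv_comp_apply (f := fun q : V × V => G.sectionLoop φ q.1 q.2)
    (by rw [h0]; exact (contDiffAt_sectionMap hφ).of_le h2) hL.contDiffAt_two, h0,
    hL.fderiv_zero, hL.fderiv_zero, (hasFDerivAt_sectionMap hφ hφ₁).fderiv,
    secondFDeriv_sectionMap hφ, ← loopM, loopM_sectionLoop hV hφ hφ₀ hφ₁ hG]
  simp

omit hV hφ₁ [FiniteDimensional ℝ 𝔤] in
lemma contDiffAt_inv_sectionMap :
    ContDiffAt ℝ 3 (fun q : V × V => G.inv (sectionMap φ q.1)) 0 :=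
  G.contDiffAt_inv.comp_at_eq ((contDiffAt_sectionMap hφ).comp_at_eq contDiffAt_fst rfl)
    (sectionMap_zero hφ₀)

omit hV [FiniteDimensional ℝ 𝔤] in
lemma fderiv_inv_sectionMap (p : V × V) :
    fderiv ℝ (fun q : V × V => G.inv (sectionMap φ q.1)) 0 p = -(p.1 : 𝔤) := by
  have h1 : (1 : WithTop ℕ∞) ≤ 3 := by norm_num
  have hs : ContDiffAt ℝ 3 (fun q : V × V => sectionMap φ q.1) 0 :=
    (contDiffAt_sectionMap hφ).comp_at_eq contDiffAt_fst rfl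
  have h0 : sectionMap φ (0 : V × V).1 = 0 := sectionMap_zero hφ₀
  rw [fderiv_comp_apply (f := fun q : V × V => sectionMap φ q.1)
    (by rw [h0]; exact G.contDiffAt_inv.of_le h1) (hs.of_le h1), h0, G.fderiv_inv,
    fderiv_comp_apply (f := fun q : V × V => q.1) ((contDiffAt_sectionMap hφ).of_le h1)
      contDiffAt_fst, show (fun q : V × V => q.1) = Prod.fst from rfl, fderiv_fst, Prod.fst_zero,
      (hasFDerivAt_sectionMap hφ hφ₁).fderiv]
  rfl

omit hV hφ₁ [FiniteDimensional ℝ 𝔤] in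
lemma secondFDeriv_inv_sectionMap (u ξ : V) :
    secondFDeriv (fun q : V × V => G.inv (sectionMap φ q.1)) 0 (u, 0) (0, ξ) = 0 := by
  have hc : ContDiffAt ℝ 2 (fun u => G.inv (sectionMap φ u)) 0 :=
    (G.contDiffAt_inv.comp_at_eq (contDiffAt_sectionMap hφ) (sectionMap_zero hφ₀)).of_le
      (by norm_num)
  have := secondFDeriv_comp_clm (ContinuousLinearMap.fst ℝ V V) (y := 0) hc (map_zero _)
    ((u, 0) : V × V) ((0, ξ) : V × V)
  simpa using this

lemma contDiffAt_psi : ContDiffAt ℝ 3 (fun q : V × V => G.psi φ q.1 q.2) 0 := by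
  have hL : IsLocalLoop (G.sectionLoop φ) := (isTransversal_section hV hφ hφ₀ hφ₁).isLocalLoop
  have h0 : G.sectionLoop φ 0 0 = 0 := hL.right_neutral.self_of_nhds
  exact G.contDiffAt_mul_comp (contDiffAt_sectionMap_sectionLoop hV hφ hφ₀ hφ₁)
    (contDiffAt_inv_sectionMap hφ hφ₀) (by simp [h0, sectionMap_zero hφ₀])
    (by simp [sectionMap_zero hφ₀, G.inv_zero])

lemma fderiv_psi (p : V × V) :
    fderiv ℝ (fun q : V × V => G.psi φ q.1 q.2) 0 p = (p.2 : 𝔤) := by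
  have hL : IsLocalLoop (G.sectionLoop φ) := (isTransversal_section hV hφ hφ₀ hφ₁).isLocalLoop
  have h0 : G.sectionLoop φ 0 0 = 0 := hL.right_neutral.self_of_nhds
  simp only [psi]
  rw [G.fderiv_mul_comp (contDiffAt_sectionMap_sectionLoop hV hφ hφ₀ hφ₁)
    (contDiffAt_inv_sectionMap hφ hφ₀) (by simp [h0, sectionMap_zero hφ₀])
    (by simp [sectionMap_zero hφ₀, G.inv_zero]), fderiv_sectionMap_sectionLoop hV hφ hφ₀ hφ₁,
    fderiv_inv_sectionMap hφ hφ₀ hφ₁]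
  abel

/-- In `(u × x) u⁻¹` the first factor contributes the quadratic part and half the projected bracket,
while its cross term with `u⁻¹` is `loopM ξ (-u)`, which is half of `[u, ξ]`. -/
lemma secondFDeriv_psi (hG : G.IsNormal) (u ξ : V) :
    secondFDeriv (fun q : V × V => G.psi φ q.1 q.2) 0 (u, 0) (0, ξ)
      = (1 / 2 : ℝ) • G.bracket u ξ
        + (1 / 2 : ℝ) • (V.projectionOnto 𝔥 hV (G.bracket u ξ) : 𝔤)
        + (2 : ℝ) • (quadraticPart φ u ξ : 𝔤) := by
  have hL : IsLocalLoop (G.sectionLoop φ) := (isTransversal_section hV hφ hφ₀ hφ₁).isLocalLoop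
  have h0 : G.sectionLoop φ 0 0 = 0 := hL.right_neutral.self_of_nhds
  simp only [psi]
  rw [G.secondFDeriv_mul_comp (contDiffAt_sectionMap_sectionLoop hV hφ hφ₀ hφ₁)
    (contDiffAt_inv_sectionMap hφ hφ₀) (by simp [h0, sectionMap_zero hφ₀])
    (by simp [sectionMap_zero hφ₀, G.inv_zero]),
    secondFDeriv_sectionMap_sectionLoop hV hφ hφ₀ hφ₁ hG, secondFDeriv_inv_sectionMap hφ hφ₀]
  simp only [fderiv_sectionMap_sectionLoop hV hφ hφ₀ hφ₁, fderiv_inv_sectionMap hφ hφ₀ hφ₁,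
    ZeroMemClass.coe_zero, neg_zero, add_zero, zero_add, IsLocalLoop.loopM_zero_right,
    IsLocalLoop.loopM_neg_right]
  rw [hG.loopM_eq, G.bracket_swap]
  module

lemma eventually_contDiffAt_psi : ∀ᶠ u in 𝓝 (0 : V),
    ContDiffAt ℝ 3 (fun q : V × V => G.psi φ q.1 q.2) (u, 0) := by
  have hc : ContinuousAt (fun u : V => (u, (0 : V))) 0 := by fun_prop
  exact hc.eventually ((contDiffAt_psi (G := G) hV hφ hφ₀ hφ₁).eventually_contDiffAt (n := 3))

lemma psi_zero_right : ∀ᶠ u in 𝓝 (0 : V), G.psi φ u 0 = 0 := by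
  have hL : IsLocalLoop (G.sectionLoop φ) := (isTransversal_section hV hφ hφ₀ hφ₁).isLocalLoop
  have hs : Tendsto (sectionMap φ) (𝓝 0) (𝓝 0) := by
    simpa [ContinuousAt, sectionMap_zero hφ₀] using (contDiffAt_sectionMap hφ).continuousAt
  filter_upwards [hL.right_neutral, hs.eventually G.mul_inv] with u h1 h2
  rw [psi, h1, h2]

/-- The differential of `Ψ_u` at the neutral element, to first order in `u`. -/
lemma hasFDerivAt_dPsi (hG : G.IsNormal) : ∃ S : V →L[ℝ] V →L[ℝ] 𝔤,
    HasFDerivAt (G.dPsi φ) S 0 ∧ ∀ u ξ, S u ξ = (1 / 2 : ℝ) • G.bracket u ξ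
        + (1 / 2 : ℝ) • (V.projectionOnto 𝔥 hV (G.bracket u ξ) : 𝔤)
        + (2 : ℝ) • (quadraticPart φ u ξ : 𝔤) := by
  have h2 : ContDiffAt ℝ 2 (fun q : V × V => G.psi φ q.1 q.2) 0 :=
    (contDiffAt_psi hV hφ hφ₀ hφ₁).of_le (by norm_num)
  have h := (h2.hasFDerivAt_fderiv.comp (f := fun u : V => (u, (0 : V))) 0
    (hasFDerivAt_prodMk_left 0 0)).clm_comp
    (hasFDerivAt_const (ContinuousLinearMap.inr ℝ V V) (0 : V))
  refine ⟨_, h.congr_of_eventuallyEq ?_, fun u ξ => ?_⟩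
  · filter_upwards [eventually_contDiffAt_psi (G := G) hV hφ hφ₀ hφ₁] with u hu
    ext1 v
    exact fderiv_partial_right (f := G.psi φ) (p := (u, 0)) (hu.differentiableAt (by norm_num)) v
  · simpa using secondFDeriv_psi hV hφ hφ₀ hφ₁ hG u ξ

lemma dPsi_zero : G.dPsi φ 0 = V.subtypeL := by
  ext1 v
  have := fderiv_partial_right (f := G.psi φ) (p := (0 : V × V))
    ((contDiffAt_psi hV hφ hφ₀ hφ₁).differentiableAt (by norm_num)) v
  rw [fderiv_psi hV hφ hφ₀ hφ₁] at this
  exact this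

omit hV [FiniteDimensional ℝ 𝔤] in
lemma hasFDerivAt_Ad_sectionMap : ∃ S : V →L[ℝ] 𝔤 →L[ℝ] 𝔤,
    HasFDerivAt (fun u => G.Ad (sectionMap φ u)) S 0 ∧ ∀ ζ h, S ζ h = G.bracket ζ h := by
  obtain ⟨S, hS, hS'⟩ := G.hasFDerivAt_Ad
  rw [← sectionMap_zero (φ := φ) hφ₀] at hS
  exact ⟨_, hS.comp (0 : V) (hasFDerivAt_sectionMap hφ hφ₁), fun ζ h => hS' ζ h⟩

/-- `Ψ_u` is itself a parametrised section through the identity. Transversality persists for small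
`u`, because at `u = 0` its differential is the inclusion of `V` and `Ad` is the identity. -/
lemma eventually_torsionOne (hG : G.IsNormal) : ∀ᶠ u in 𝓝 (0 : V),
    Function.Injective (G.dPsi φ u) ∧
    IsCompl (LinearMap.range (G.dPsi φ u).toLinearMap)
      (𝔥.map (G.Ad (sectionMap φ u)).toLinearMap) ∧
    ∀ ξ η : V, G.torsionOne φ u ξ η
        = -((1 / 2 : ℝ) • (((G.dPsi φ u).comp (ContinuousLinearMap.fst ℝ V 𝔥)
          + (G.Ad (sectionMap φ u)).comp (𝔥.subtypeL.comp (ContinuousLinearMap.snd ℝ V 𝔥))).inverse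
          (G.bracket (G.dPsi φ u ξ) (G.dPsi φ u η))).1) ∧
      G.dPsi φ u (G.torsionOne φ u ξ η)
        = -((1 / 2 : ℝ) • projAlong (LinearMap.range (G.dPsi φ u).toLinearMap)
          (𝔥.map (G.Ad (sectionMap φ u)).toLinearMap)
          (G.bracket (G.dPsi φ u ξ) (G.dPsi φ u η))) := by
  obtain ⟨A, hA, -⟩ := hasFDerivAt_dPsi (G := G) hV hφ hφ₀ hφ₁ hG
  obtain ⟨B, hB, -⟩ := hasFDerivAt_Ad_sectionMap (G := G) hφ hφ₀ hφ₁
  have hB0 : G.Ad (sectionMap φ 0) = ContinuousLinearMap.id ℝ 𝔤 := by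
    rw [sectionMap_zero hφ₀, G.Ad_zero]
  have hev := (hasFDerivAt_splitting_inverse hV hA hB
    (hasFDerivAt_const (0 : 𝔤) (0 : V)) (dPsi_zero hV hφ hφ₀ hφ₁) hB0).1
  have hs : Tendsto (sectionMap φ) (𝓝 0) (𝓝 0) := by
    simpa [ContinuousAt, sectionMap_zero hφ₀] using (contDiffAt_sectionMap hφ).continuousAt
  filter_upwards [hev, hs.eventually G.eventually_contDiffAt_conj, hs.eventually G.conj_zero_right,
    eventually_contDiffAt_psi (G := G) hV hφ hφ₀ hφ₁,
    psi_zero_right (G := G) hV hφ hφ₀ hφ₁] with u h1 h2 h3 h4 h5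
  exact conjugate_torsion (h4.comp_at_eq (f := fun x : V => (u, x))
    (contDiffAt_const.prodMk contDiffAt_id) rfl) h5 h2 h3 h1

lemma hasFDerivAt_torsionOne (hG : G.IsNormal) (ξ η : V) : ∃ S : V →L[ℝ] V,
    HasFDerivAt (fun u => G.torsionOne φ u ξ η) S 0 ∧ ∀ ζ, S ζ =
      -((1 / 4 : ℝ) • V.projectionOnto 𝔥 hV (G.bracket (G.bracket ξ ζ) η))
        + (1 / 4 : ℝ) • V.projectionOnto 𝔥 hV
          (G.bracket (V.projectionOnto 𝔥 hV (G.bracket ξ ζ)) η)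
        - V.projectionOnto 𝔥 hV (G.bracket (quadraticPart φ ξ ζ) η)
        + (1 / 4 : ℝ) • V.projectionOnto 𝔥 hV (G.bracket (G.bracket η ζ) ξ)
        - (1 / 4 : ℝ) • V.projectionOnto 𝔥 hV
          (G.bracket (V.projectionOnto 𝔥 hV (G.bracket η ζ)) ξ)
        + V.projectionOnto 𝔥 hV (G.bracket (quadraticPart φ η ζ) ξ) := by
  obtain ⟨A, hA, hA'⟩ := hasFDerivAt_dPsi (G := G) hV hφ hφ₀ hφ₁ hG
  obtain ⟨B, hB, hB'⟩ := hasFDerivAt_Ad_sectionMap (G := G) hφ hφ₀ hφ₁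
  have hB0 : G.Ad (sectionMap φ 0) = ContinuousLinearMap.id ℝ 𝔤 := by
    rw [sectionMap_zero hφ₀, G.Ad_zero]
  have hA0 := dPsi_zero (G := G) hV hφ hφ₀ hφ₁
  obtain ⟨w', hw, hw'⟩ := hasFDerivAt_bracket (G := G)
    (hA.clm_apply (hasFDerivAt_const ξ (0 : V))) (hA.clm_apply (hasFDerivAt_const η (0 : V)))
  obtain ⟨S, hS, hS'⟩ := (hasFDerivAt_splitting_inverse hV hA hB hw hA0 hB0).2
  refine ⟨S, hS.congr_of_eventuallyEq ?_, fun ζ => ?_⟩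
  · filter_upwards [eventually_torsionOne (G := G) hV hφ hφ₀ hφ₁ hG] with u hu
    exact (hu.2.2 ξ η).1
  · have hw'' : w' ζ = G.bracket (A ζ ξ) η + G.bracket ξ (A ζ η) := by
      rw [hw']; simp [hA0]
    rw [hS', hw'', hA0]
    -- After projection the derivative of `dPsi` at `Π[ξ, η]` is `Π[ζ, Π[ξ, η]]`. It cancels the
    -- corresponding term from `Ad`, so the moving splitting contributes only a multiple of `Π[[ξ,
    -- η], ζ]`.
    simp only [Submodule.subtypeL_apply, hA', hB', G.bracket_swap ξ (_ + _), G.bracket_swap ζ,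
      quadraticPart_symm hφ ζ, bracket_add_left, bracket_smul_left, bracket_neg_left, map_sub,
      map_add, map_neg, map_smul, Submodule.projectionOnto_apply_left, Submodule.coe_neg,
      Submodule.projectionOnto_apply_right, bracket_sub_left]
    -- The remaining double bracket is not of the shape in the target; the Jacobi identity splits it
    -- into the two that are.
    rw [hG.jacobi (ξ : 𝔤) (η : 𝔤) ζ, map_sub]
    module

end TorsionOne

end LocalLieGroup

/-! ### Assembly of the theorem. -/

theorem mainTheorem3 {𝔤 : Type*} [NormedAddCommGroup 𝔤] [NormedSpace ℝ 𝔤] [FiniteDimensional ℝ 𝔤]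
    (G : LocalLieGroup 𝔤) (hG : G.IsNormal)
    (V 𝔥 : Submodule ℝ 𝔤) (hV : IsCompl V 𝔥) (h𝔥 : G.IsLocalSubgroup 𝔥)
    (φ : V → 𝔥) (hφ : ∀ᶠ ξ in 𝓝 (0 : V), ContDiffAt ℝ ∞ φ ξ)
    (hφ₀ : φ 0 = 0) (hφ₁ : fderiv ℝ φ 0 = 0) :
    let pr : 𝔤 → V := fun w => V.projectionOnto 𝔥 hV w
    let br : 𝔤 → 𝔤 → 𝔤 := G.bracket
    let R : V → V → 𝔥 := quadraticPart φ
    let m : V → V → V := G.sectionLoop φ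
    let F₂ : V → V → V → V := fun ξ η ζ =>
      -((1 / 2 : ℝ) • pr (br (br ξ η) ζ)) + (1 / 2 : ℝ) • pr (br (pr (br ξ η)) ζ)
    let F₁ : V → V → V → V := fun ξ η ζ =>
      -((1 / 4 : ℝ) • pr (br (br ξ ζ) η)) + (1 / 4 : ℝ) • pr (br (pr (br ξ ζ)) η)
        - pr (br (R ξ ζ) η)
        + (1 / 4 : ℝ) • pr (br (br η ζ) ξ) - (1 / 4 : ℝ) • pr (br (pr (br η ζ)) ξ)
        + pr (br (R η ζ) ξ)
    -- the torsion of the loops attached to the conjugated subgroups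
    (∀ᶠ g in 𝓝 (0 : 𝔤), IsCompl V (𝔥.map (G.Ad g).toLinearMap) ∧
      ∀ ξ η : V, (G.torsionTwo φ g ξ η : 𝔤)
        = -((1 / 2 : ℝ) • projAlong V (𝔥.map (G.Ad g).toLinearMap) (br ξ η))) ∧
    (∀ᶠ u in 𝓝 (0 : V), Function.Injective (G.dPsi φ u) ∧
      IsCompl (LinearMap.range (G.dPsi φ u).toLinearMap)
        (𝔥.map (G.Ad (sectionMap φ u)).toLinearMap) ∧
      ∀ ξ η : V, G.dPsi φ u (G.torsionOne φ u ξ η)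
        = -((1 / 2 : ℝ) • projAlong (LinearMap.range (G.dPsi φ u).toLinearMap)
            (𝔥.map (G.Ad (sectionMap φ u)).toLinearMap)
            (br (G.dPsi φ u ξ) (G.dPsi φ u η)))) ∧
    -- the differential of `Ψ_u` to first order in `u`
    (∀ ξ : V, Asymptotics.IsLittleO (𝓝 (0 : V))
      (fun u : V => G.dPsi φ u ξ - ((ξ : 𝔤) + (1 / 2 : ℝ) • br u ξ
        + (1 / 2 : ℝ) • (pr (br u ξ) : 𝔤) + (2 : ℝ) • (R u ξ : 𝔤)))
      (fun u : V => u)) ∧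
    -- the two covariant derivatives of the torsion
    (∀ ξ η ζ : V,
      HasDerivAt (fun t : ℝ => G.torsionTwo φ (t • (ζ : 𝔤)) ξ η) (F₂ ξ η ζ) 0 ∧
      HasDerivAt (fun t : ℝ => G.torsionTwo φ (sectionMap φ (t • ζ)) ξ η) (F₂ ξ η ζ) 0 ∧
      nablaTwoTorsion m 0 ξ η ζ = F₂ ξ η ζ ∧
      nablaTwoTorsion m 0 ξ η ζ
        = (1 / 2 : ℝ) • (chernCurvature m 0 ξ η ζ - chernCurvature m 0 η ξ ζ)) ∧
    (∀ ξ η ζ : V,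
      HasDerivAt (fun t : ℝ => G.torsionOne φ (t • ζ) ξ η) (F₁ ξ η ζ) 0 ∧
      nablaOneTorsion m 0 ξ η ζ = F₁ ξ η ζ ∧
      nablaOneTorsion m 0 ξ η ζ
        = (1 / 2 : ℝ) • (chernCurvature m 0 ξ ζ η - chernCurvature m 0 η ζ ξ)) := by
  have hφ3 : ContDiffAt ℝ 3 φ 0 := hφ.self_of_nhds.of_le (WithTop.coe_le_coe.2 le_top)
  have : CompleteSpace V := FiniteDimensional.complete ℝ V
  intro pr br R m F₂ F₁
  have hL : IsLocalLoop m := (LocalLieGroup.isTransversal_section hV hφ3 hφ₀ hφ₁).isLocalLoop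
  have hline : ∀ ζ : V, HasDerivAt (fun t : ℝ => t • ζ) ζ 0 := fun ζ => by
    simpa using (hasDerivAt_id (0 : ℝ)).smul_const ζ
  refine ⟨?_, ?_, fun ξ => ?_, fun ξ η ζ => ⟨?_, ?_, ?_, ?_⟩, fun ξ η ζ => ⟨?_, ?_, ?_⟩⟩
  · filter_upwards [LocalLieGroup.eventually_torsionTwo (G := G) hV hφ3 hφ₀ hφ₁] with g hg
    exact ⟨hg.1, fun ξ η => (hg.2 ξ η).2⟩
  · filter_upwards [LocalLieGroup.eventually_torsionOne (G := G) hV hφ3 hφ₀ hφ₁ hG] with u hu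
    exact ⟨hu.1, hu.2.1, fun ξ η => (hu.2.2 ξ η).2⟩
  · obtain ⟨S, hS, hS'⟩ := LocalLieGroup.hasFDerivAt_dPsi (G := G) hV hφ3 hφ₀ hφ₁ hG
    -- The expansion with remainder `o(u)` is Fréchet differentiability of `u ↦ dPsi u ξ` at `0`.
    have h := (hS.clm_apply (hasFDerivAt_const ξ (0 : V))).isLittleO
    simp only [sub_zero] at h
    refine h.congr_left fun u => ?_
    simp [LocalLieGroup.dPsi_zero (G := G) hV hφ3 hφ₀ hφ₁, hS', pr, br, R]
    abel
  · obtain ⟨S, hS, hS'⟩ := LocalLieGroup.hasFDerivAt_torsionTwo (G := G) hV hφ3 hφ₀ hφ₁ ξ η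
    have hc : HasDerivAt (fun t : ℝ => t • (ζ : 𝔤)) (ζ : 𝔤) 0 := by
      simpa using (hasDerivAt_id (0 : ℝ)).smul_const (ζ : 𝔤)
    have h := hS.comp_hasDerivAt_of_eq (0 : ℝ) hc (by simp)
    rw [hS'] at h
    exact h
  · obtain ⟨S, hS, hS'⟩ := LocalLieGroup.hasFDerivAt_torsionTwo (G := G) hV hφ3 hφ₀ hφ₁ ξ η
    -- As `φ` has zero differential at `0`, this curve has the same velocity as `t ζ`, hence the
    -- same derivative of the torsion.
    have hc : HasDerivAt (fun t : ℝ => sectionMap φ (t • ζ)) (ζ : 𝔤) 0 :=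
      (LocalLieGroup.hasFDerivAt_sectionMap hφ3 hφ₁).comp_hasDerivAt_of_eq (0 : ℝ) (hline ζ)
        (by simp)
    have h := hS.comp_hasDerivAt_of_eq (0 : ℝ) hc (by simp [LocalLieGroup.sectionMap_zero hφ₀])
    rw [hS'] at h
    exact h
  · exact LocalLieGroup.nablaTwoTorsion_sectionLoop hV hφ3 hφ₀ hφ₁ hG h𝔥 ξ η ζ
  · exact hL.nablaTwoTorsion_zero_eq_chernCurvature ξ η ζ
  · obtain ⟨S, hS, hS'⟩ := LocalLieGroup.hasFDerivAt_torsionOne (G := G) hV hφ3 hφ₀ hφ₁ hG ξ η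
    have h := hS.comp_hasDerivAt_of_eq (0 : ℝ) (hline ζ) (by simp)
    rw [hS'] at h
    exact h
  · exact LocalLieGroup.nablaOneTorsion_sectionLoop hV hφ3 hφ₀ hφ₁ hG h𝔥 ξ η ζ
  · exact hL.nablaOneTorsion_zero_eq_chernCurvature ξ η ζ
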